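/- Let $p$ be a prime, $m\ge 2$, and let $\chi$ be a Dirichlet character mod $p^m$. Write $e_y(x)=e^{2\pi i x/y}$ and $$G(\chi,p^m)=\sum_{x=1}^{p^m}\chi(x)\,e_{p^m}(x),\qquad \omega=e^{\pi i/4},\qquad \varepsilon_{p^m}=\begin{cases}1,& p^m\equiv 1 \bmod 4,\\ i,& p^m\equiv 3\bmod 4.\end{cases}$$ For $p$ odd, let $a$ be any primitive root mod $p^m$, define integers $r$ and $R_j$ ($j\ge1$) by $a^{\phi(p)}=1+rp$ and $a^{\phi(p^j)}=1+R_jp^j$, and define $c$ by $\chi(a)=e_{\phi(p^m)}(c)$, $1\le c\le\phi(p^m)$. For $p=2$ define integers $R_j$ ($j\ge 2$) by $5^{2^{j-2}}=1+R_j2^j$ and, for $m\ge 3$, define $c$ by $\chi(5)=e_{2^{m-2}}(c)$, $1\le c\le 2^{m-2}$. Below, $x^{-1}$ denotes the inverse of $x$ mod $p^m$, and $\left(\frac{\cdot}{\cdot}\right)$ is the Legendre/Jacobi symbol. If $\chi$ is imprimitive, then $G(\chi,p^m)=0$. If $\chi$ is primitive, then: (i) if $p$ is odd and $p^m\ne 27$,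 then for every $j\ge\lceil m/2\rceil$ $$G(\chi,p^m)=p^{m/2}\,\chi(-cR_j^{-1})\,e_{p^m}(-cR_j^{-1})\left(\frac{-2rc}{p}\right)^m\varepsilon_{p^m};$$ if $p^m=27$, the same formula holds for every $j\ge 2$ with the right-hand side multiplied by $e_3(-rc)$; (ii) if $p=2$ and $m\ge5$, then for every $j\ge\lceil m/2\rceil+2$ $$G(\chi,2^m)=2^{m/2}\,\chi(-cR_j^{-1})\,e_{2^m}(-cR_j^{-1})\left(\frac{2}{c}\right)^m\omega^{c};$$ (iii) if $p=2$ and $m=2,3,4$, then $G(\chi,2^m)$ equals $2^{m/2}\,i$, $\;2^{m/2}\,\omega^{1-\chi(-1)}$, $\;2^{m/2}\,\chi(-c)\,e_{16}(-c)$ respectively. -/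

import Mathlib

noncomputable section

namespace PrimePowerGauss

/-- The classical Gauss sum `∑_{x mod q} χ(x) e^{2πix/q}`.
Here `ZMod.stdAddChar` is the additive character `x ↦ e^{2πix/q}` of `ℤ/qℤ`. -/
def G {q : ℕ} [NeZero q] (χ : DirichletCharacter ℂ q) : ℂ :=
  gaussSum χ (ZMod.stdAddChar (N := q))

/-- The integer `a` is a primitive root mod `q`. -/
def IsPrimitiveRootMod (a : ℤ) (q : ℕ) : Prop :=
  orderOf (a : ZMod q) = Nat.totient q

/-- The integer `r` with `a ^ φ(p) = 1 + r p`, for `a` prime to `p`. -/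
def r (p : ℕ) (a : ℤ) : ℤ := (a ^ Nat.totient p - 1) / (p : ℤ)

/-- The integer `R_j` with `a ^ φ(p ^ j) = 1 + R_j p ^ j`, for `a` prime to `p` (used for odd `p`). -/
def R (p : ℕ) (a : ℤ) (j : ℕ) : ℤ := (a ^ Nat.totient (p ^ j) - 1) / (p : ℤ) ^ j

/-- The integer `R_j`, `j ≥ 2`, with `5 ^ (2 ^ (j - 2)) = 1 + R_j 2 ^ j` (used for `p = 2`). -/
def Rtwo (j : ℕ) : ℤ := ((5 : ℤ) ^ (2 ^ (j - 2)) - 1) / (2 : ℤ) ^ j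

/-- `c` is the integer with `1 ≤ c ≤ N` and `z = e^{2πic/N}`. -/
def IsIndex (N : ℕ) (z : ℂ) (c : ℕ) : Prop :=
  1 ≤ c ∧ c ≤ N ∧ z = Complex.exp (2 * Real.pi * Complex.I * c / N)

/-- `ε_q`, for odd `q`: it is `1` if `q ≡ 1 mod 4` and `i` if `q ≡ 3 mod 4`. -/
def eps (q : ℕ) : ℂ := if q % 4 = 1 then 1 else Complex.I

/-- `ω = e^{πi/4}`. -/
def omega : ℂ := Complex.exp (Real.pi * Complex.I / 4)

/-- The divisions in the definitions of `r` and `R` are exact. -/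
theorem R_spec (p : ℕ) (a : ℤ) (j : ℕ) (h : IsCoprime a (p : ℤ)) :
    a ^ Nat.totient (p ^ j) = 1 + R p a j * (p : ℤ) ^ j := by
  have h1 : IsUnit (a : ZMod (p ^ j)) := by
    rw [ZMod.coe_int_isUnit_iff_isCoprime]
    push_cast
    exact h.symm.pow_left
  obtain ⟨u, hu⟩ := h1
  have h2 : ((a ^ Nat.totient (p ^ j) : ℤ) : ZMod (p ^ j)) = ((1 : ℤ) : ZMod (p ^ j)) := by
    push_cast
    rw [← hu, ← Units.val_pow_eq_pow_val, ZMod.pow_totient, Units.val_one]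
  have h3 : ((p : ℤ) ^ j) ∣ a ^ Nat.totient (p ^ j) - 1 := by
    have := (ZMod.intCast_eq_intCast_iff_dvd_sub _ _ _).1 h2.symm
    exact_mod_cast this
  rw [R, Int.ediv_mul_cancel h3]
  ring

theorem r_eq_R_one (p : ℕ) (a : ℤ) : r p a = R p a 1 := by
  simp [r, R]

/-- The division in the definition of `Rtwo` is exact. -/
theorem Rtwo_spec (j : ℕ) (hj : 2 ≤ j) :
    (5 : ℤ) ^ (2 ^ (j - 2)) = 1 + Rtwo j * (2 : ℤ) ^ j := by
  have h3 : (2 : ℤ) ^ j ∣ (5 : ℤ) ^ (2 ^ (j - 2)) - 1 := by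
    obtain ⟨k, rfl⟩ := Nat.exists_eq_add_of_le' hj
    rw [Nat.add_sub_cancel]
    induction k with
    | zero => norm_num
    | succ k ih =>
      have e : (5 : ℤ) ^ (2 ^ (k + 1)) - 1 = (5 ^ (2 ^ k) - 1) * ((5 ^ (2 ^ k) - 1) + 2) := by
        rw [pow_succ 2 k, pow_mul]; ring
      rw [e, show k + 1 + 2 = (k + 2) + 1 by ring, pow_succ]
      have ih' := ih (by omega)
      refine mul_dvd_mul ih' (dvd_add ((dvd_pow_self 2 (by omega)).trans ih') dvd_rfl)
  rw [Rtwo, Int.ediv_mul_cancel h3]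
  ring

/-- Every `N`-th root of unity has exactly one index. -/
theorem existsUnique_isIndex (N : ℕ) (hN : 1 ≤ N) (z : ℂ) (hz : z ^ N = 1) :
    ∃! c : ℕ, IsIndex N z c := by
  have hN0 : N ≠ 0 := by omega
  have hp := Complex.isPrimitiveRoot_exp N hN0
  have hN' : (N : ℂ) ≠ 0 := by exact_mod_cast hN0
  have key (c : ℕ) : Complex.exp (2 * Real.pi * Complex.I * c / N) =
      Complex.exp (2 * Real.pi * Complex.I / N) ^ c := by
    rw [← Complex.exp_nat_mul]
    congr 1
    ring
  have : NeZero N := ⟨hN0⟩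
  obtain ⟨i, hi, hiz⟩ := hp.eq_pow_of_pow_eq_one hz
  have uniq : ∀ c d : ℕ, 1 ≤ c → c ≤ N → 1 ≤ d → d ≤ N →
      Complex.exp (2 * Real.pi * Complex.I / N) ^ c =
      Complex.exp (2 * Real.pi * Complex.I / N) ^ d → c = d := by
    intro c d hc hc' hd hd' h
    obtain ⟨c, rfl⟩ := Nat.exists_eq_add_of_le' hc
    obtain ⟨d, rfl⟩ := Nat.exists_eq_add_of_le' hd
    rw [pow_succ, pow_succ] at h
    rw [hp.pow_inj (by omega) (by omega) (mul_right_cancel₀ (Complex.exp_ne_zero _) h)]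
  obtain ⟨c, hc, hc', hcz⟩ : ∃ c : ℕ, 1 ≤ c ∧ c ≤ N ∧
      Complex.exp (2 * Real.pi * Complex.I / N) ^ c = z := by
    rcases Nat.eq_zero_or_pos i with rfl | h0
    · exact ⟨N, hN, le_rfl, by rw [hp.pow_eq_one, ← hiz, pow_zero]⟩
    · exact ⟨i, h0, hi.le, hiz⟩
  refine ⟨c, ⟨hc, hc', by rw [key, hcz]⟩, ?_⟩
  rintro d ⟨hd, hd', hdz⟩
  exact uniq d c hd hd' hc hc' (by rw [hcz, hdz, key])

end PrimePowerGauss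

end

/-! The proof is a p-adic stationary phase argument. Write f(x) = χ(x) e(x/p^m). Multiplying x by 1
+ p^J y with 2J ≥ m changes f(x) by an additive character of y, because χ restricted to 1 + p^J ℤ is
itself additive: it equals e(-x₁ p^J y / p^m) for a suitable x₁ (`IsStationary`). Averaging over y
leaves only the x with p^J (x - x₁) = 0 (`G_eq_sum_stationary`).

For m = 2k the surviving terms are all equal (`G_eq_of_even`). For m = 2k + 1 they fall into p
classes, reached by the powers of 1 + R p^k (`G_eq_of_odd`), and what remains is a sum of length p.

Since a^φ(p^j) = 1 + R_j p^j, applying χ shows that x₁ must satisfy x₁ R_J + c ≡ 0 to the precision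
needed. The R_j form a p-adically convergent sequence, so one x₁ = -c/R_j serves for all large j.
For odd p and odd m, the second-order recursion for R_j cancels the linear part of the phase,
leaving a quadratic Gauss sum mod p (`dvd_two_mul_phase_sub`); its sign is obtained from theta
functions (`sum_exp_sq_eq`). When p^m = 27 the cubic binomial term contributes a linear phase, and
completing the square produces the extra cube root of unity.

For p = 2 the R_j converge one binary digit more slowly. The resulting discrepancy R_j - R_i, known
to three binary digits (`exists_Rtwo_sub_eq`), yields the power of ω. The moduli 4, 8 and 16 are
treated directly. In the imprimitive case x₁ = 0, so only multiples of p survive, and χ vanishes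
there. -/

noncomputable section

namespace PrimePowerGauss

/-! ### Quadratic Gauss sums over ℤ/p, with sign, from theta asymptotics -/

section Theta

open Complex Filter Topology

/-- Poisson summation after completing the square; the shift r turns into a phase e(nr/N) on the
dual side. -/
theorem tsum_exp_neg_sq_residue (N : ℕ) (hN : N ≠ 0) (r : ℂ) {t : ℂ} (ht : 0 < t.re) :
    ((N : ℂ) ^ 2 * t) ^ (1 / 2 : ℂ) * ∑' n : ℤ, cexp (-Real.pi * t * (n * N + r) ^ 2) =
      ∑' n : ℤ, cexp (-Real.pi / ((N : ℂ) ^ 2 * t) * n ^ 2 + 2 * Real.pi * I * n * r / N) := by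
  have hN' : (N : ℂ) ≠ 0 := by exact_mod_cast hN
  have ht0 : t ≠ 0 := by rintro rfl; simp at ht
  have ha : 0 < ((N : ℂ) ^ 2 * t).re := by
    have : (N : ℂ) ^ 2 * t = ((N ^ 2 : ℝ) : ℂ) * t := by push_cast; ring
    rw [this, re_ofReal_mul]
    have : (N : ℝ) ≠ 0 := by exact_mod_cast hN
    positivity
  have hne : ((N : ℂ) ^ 2 * t) ^ (1 / 2 : ℂ) ≠ 0 := by
    rw [Ne, cpow_eq_zero_iff]
    simp [hN', ht0]
  have key := Complex.tsum_exp_neg_quadratic ha (-(N * t * r))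
  have e1 : ∀ n : ℤ, cexp (-Real.pi * t * (n * N + r) ^ 2) = cexp (-Real.pi * t * r ^ 2) *
      cexp (-Real.pi * ((N : ℂ) ^ 2 * t) * n ^ 2 + 2 * Real.pi * (-(N * t * r)) * n) := by
    intro n
    rw [← Complex.exp_add]
    ring_nf
  have e2 : ∀ n : ℤ, cexp (-Real.pi / ((N : ℂ) ^ 2 * t) * n ^ 2 + 2 * Real.pi * I * n * r / N) =
      cexp (-Real.pi * t * r ^ 2) *
        cexp (-Real.pi / ((N : ℂ) ^ 2 * t) * (n + I * (-(N * t * r))) ^ 2) := by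
    intro n
    rw [← Complex.exp_add]
    congr 1
    field_simp
    ring_nf
    rw [I_sq]
    ring
  simp_rw [e1, e2, tsum_mul_left, key]
  field_simp

/-- On the dual side every term with n ≠ 0 decays as Re(1/t) → ∞, so each residue class mod N
contributes the same leading term, whatever r is. -/
theorem tendsto_tsum_exp_neg_sq_residue {ι : Type*} {l : Filter ι} [l.IsCountablyGenerated]
    (N : ℕ) (hN : N ≠ 0) (r : ℤ)
    {t : ι → ℂ} (ht : Tendsto (fun i => (1 / t i).re) l atTop) :
    Tendsto (fun i => ((N : ℂ) ^ 2 * t i) ^ (1 / 2 : ℂ) *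
      ∑' n : ℤ, cexp (-Real.pi * t i * (n * N + r) ^ 2)) l (𝓝 1) := by
  have hNr : (0 : ℝ) < N := by positivity
  have hpos : ∀ᶠ i in l, 0 < (t i).re := by
    filter_upwards [ht.eventually_gt_atTop 0] with i hi
    rw [one_div, inv_re] at hi
    by_contra h
    exact absurd hi (not_lt.2 (div_nonpos_of_nonpos_of_nonneg (not_lt.1 h) (normSq_nonneg _)))
  have hy : Tendsto (fun i => (1 / t i).re / (N : ℝ) ^ 2) l atTop :=
    ht.atTop_div_const (by positivity)
  have hnorm : ∀ i (n : ℤ), ‖cexp (-Real.pi / ((N : ℂ) ^ 2 * t i) * n ^ 2 +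
      2 * Real.pi * I * n * r / N)‖ =
        Real.exp (-Real.pi * n ^ 2 * ((1 / t i).re / (N : ℝ) ^ 2)) := by
    intro i n
    rw [norm_exp]
    congr 1
    have : -Real.pi / ((N : ℂ) ^ 2 * t i) * n ^ 2 + 2 * Real.pi * I * n * r / N =
      ((-Real.pi * n ^ 2 / (N : ℝ) ^ 2 : ℝ) : ℂ) * (1 / t i) +
        ((2 * Real.pi * n * r / N : ℝ) : ℂ) * I := by
      push_cast
      rw [← div_div]
      ring
    rw [this, add_re, re_ofReal_mul, re_ofReal_mul, I_re]
    ring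
  have hb : Summable fun n : ℤ => Real.exp (-Real.pi * n ^ 2) := by
    have := (summable_jacobiTheta₂_term_iff 0 I).2 (by simp)
    refine this.norm.congr fun n => ?_
    rw [norm_jacobiTheta₂_term]
    simp
  have main : Tendsto (fun i => ∑' n : ℤ, cexp (-Real.pi / ((N : ℂ) ^ 2 * t i) * n ^ 2 +
      2 * Real.pi * I * n * r / N)) l (𝓝 (∑' n : ℤ, if n = 0 then (1 : ℂ) else 0)) := by
    refine tendsto_tsum_of_dominated_convergence hb (fun n => ?_) ?_
    · split_ifs with h
      · subst h; simp [tendsto_const_nhds]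
      · rw [tendsto_zero_iff_norm_tendsto_zero]
        simp_rw [hnorm]
        refine Real.tendsto_exp_atBot.comp (hy.const_mul_atTop_of_neg ?_)
        have : (n : ℝ) ≠ 0 := by exact_mod_cast h
        have := Real.pi_pos
        have : 0 < Real.pi * (n : ℝ) ^ 2 := by positivity
        linarith
    · filter_upwards [hy.eventually_ge_atTop 1] with i hi n
      rw [hnorm]
      refine Real.exp_le_exp.2 ?_
      have : 0 ≤ Real.pi * (n : ℝ) ^ 2 := by have := Real.pi_pos; positivity
      nlinarith
  rw [tsum_ite_eq] at main
  refine main.congr' ?_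
  filter_upwards [hpos] with i hi
  rw [← tsum_exp_neg_sq_residue N hN r hi]

theorem summable_exp_neg_sq {t : ℂ} (ht : 0 < t.re) :
    Summable fun n : ℤ => cexp (-Real.pi * t * n ^ 2) := by
  have := (summable_jacobiTheta₂_term_iff 0 (I * t)).2 (by simpa using ht)
  refine this.congr fun n => ?_
  rw [jacobiTheta₂_term]
  congr 1
  ring_nf
  rw [I_sq]
  ring

theorem tendsto_tsum_periodic_mul_exp_neg_sq {ι : Type*} {l : Filter ι} [l.IsCountablyGenerated]
    (N : ℕ) [NeZero N] {c : ℤ → ℂ} (hc : Function.Periodic c N)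
    {t : ι → ℂ} (ht : Tendsto (fun i => (1 / t i).re) l atTop) :
    Tendsto (fun i => ((N : ℂ) ^ 2 * t i) ^ (1 / 2 : ℂ) *
      ∑' n : ℤ, c n * cexp (-Real.pi * t i * n ^ 2)) l (𝓝 (∑ r : Fin N, c r)) := by
  have hpos : ∀ᶠ i in l, 0 < (t i).re := by
    filter_upwards [ht.eventually_gt_atTop 0] with i hi
    rw [one_div, inv_re] at hi
    by_contra h
    exact absurd hi (not_lt.2 (div_nonpos_of_nonpos_of_nonneg (not_lt.1 h) (normSq_nonneg _)))
  have main : Tendsto (fun i => ∑ r : Fin N, c r * (((N : ℂ) ^ 2 * t i) ^ (1 / 2 : ℂ) *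
      ∑' n : ℤ, cexp (-Real.pi * t i * (n * N + (r : ℤ)) ^ 2))) l (𝓝 (∑ r : Fin N, c r * 1)) :=
    tendsto_finsetSum _ fun r _ =>
      (tendsto_tsum_exp_neg_sq_residue N (NeZero.ne N) r ht).const_mul _
  simp_rw [mul_one] at main
  refine main.congr' ?_
  filter_upwards [hpos] with i hi
  have hs : Summable fun n : ℤ => c n * cexp (-Real.pi * t i * n ^ 2) := by
    obtain ⟨M, hM⟩ : ∃ M : ℝ, ∀ n, ‖c n‖ ≤ M := by
      refine ⟨∑ r : Fin N, ‖c r‖, fun n => ?_⟩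
      obtain ⟨r, k, hk⟩ : ∃ (r : Fin N) (k : ℤ), n = r + k * N := by
        have h := (Int.divModEquiv N).symm_apply_apply n
        rw [Int.divModEquiv_symm_apply] at h
        exact ⟨_, _, by rw [add_comm]; exact h.symm⟩
      have h2 : c n = c r := by
        rw [hk]
        have := hc.int_mul k (r : ℤ)
        simpa using this
      rw [h2]
      exact Finset.single_le_sum (f := fun r : Fin N => ‖c r‖) (fun _ _ => norm_nonneg _)
        (Finset.mem_univ r)
    refine Summable.of_norm_bounded ((summable_exp_neg_sq hi).norm.mul_left M) fun n => ?_
    rw [norm_mul]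
    exact mul_le_mul_of_nonneg_right (hM n) (norm_nonneg _)
  have h3 := (Int.divModEquiv N).symm.summable_iff.2 hs
  have h4 : ∀ (r : Fin N) (n : ℤ), c (n * N + r) = c r := fun r n => by
    have := hc.int_mul n (r : ℤ)
    rw [add_comm]
    simpa using this
  rw [← (Int.divModEquiv N).symm.tsum_eq, ← (Equiv.prodComm _ _).tsum_eq]
  refine Eq.trans ?_ (congrArg _ ((Equiv.prodComm _ _).summable_iff.2 h3).tsum_prod.symm)
  rw [tsum_fintype, Finset.mul_sum]
  refine Finset.sum_congr rfl fun r _ => ?_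
  simp only [Function.comp_apply, Equiv.prodComm_apply, Prod.swap, Int.divModEquiv_symm_apply, h4]
  rw [tsum_mul_left]
  push_cast
  ring

/-- The Landsberg–Schaar argument: theta near the boundary point -2i/p has leading coefficient given
by the sum mod p, while the theta transformation sends that point to pi/2, where the coefficient is
a sum with only two terms. Equating the two limits gives the formula. -/
theorem sum_exp_sq_eq (p : ℕ) (hp : p ≠ 0) :
    ∑ r : Fin p, cexp (2 * Real.pi * I * ((r : ℤ) : ℂ) ^ 2 / p) =
      (Real.sqrt p : ℂ) * ((1 + I) / 2 * (1 + (-I) ^ p)) := by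
  have : NeZero p := ⟨hp⟩
  have hpr : (0 : ℝ) < p := by positivity
  have hpc : (p : ℂ) ≠ 0 := by exact_mod_cast hp
  set a : ℝ → ℂ := fun ε => ε - 2 * I / p with ha
  have hane : ∀ ε, a ε ≠ 0 := fun ε h => by
    have := congrArg Complex.im h
    have h2 : (a ε).im = -(2 / p) := by
      have : a ε = ((ε : ℝ) : ℂ) + ((-(2 / p) : ℝ) : ℂ) * I := by
        simp only [ha]; push_cast; ring
      rw [this]; simp
    rw [h2, zero_im, neg_eq_zero] at this
    exact absurd this (by positivity)
  -- δ is the distance of 1/a from its boundary value pi/2, so it measures the approach to the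
  -- boundary on the dual side.
  set δ : ℝ → ℂ := fun ε => -(p * I / 2) * ε / a ε with hδ
  have hainv : ∀ ε, 1 / a ε = p * I / 2 + δ ε := fun ε => by
    have h1 := hane ε
    simp only [hδ]
    field_simp
    simp only [ha]
    field_simp
    ring_nf
    rw [I_sq]
    ring
  have ht1 : Tendsto (fun ε : ℝ => (1 / (ε : ℂ)).re) (𝓝[>] 0) atTop := by
    have : (fun ε : ℝ => (1 / (ε : ℂ)).re) = fun ε => ε⁻¹ := by
      ext ε; rw [← ofReal_one, ← ofReal_div, ofReal_re, one_div]
    rw [this]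
    exact tendsto_inv_nhdsGT_zero
  have ht2 : Tendsto (fun ε : ℝ => (1 / δ ε).re) (𝓝[>] 0) atTop := by
    have : Tendsto (fun ε : ℝ => 4 / (p : ℝ) ^ 2 * ε⁻¹) (𝓝[>] 0) atTop :=
      tendsto_inv_nhdsGT_zero.const_mul_atTop (by positivity)
    refine this.congr' ?_
    filter_upwards [self_mem_nhdsWithin] with ε hε
    have hε' : (ε : ℂ) ≠ 0 := by exact_mod_cast (ne_of_gt hε)
    have h1 : 1 / δ ε = ((4 / (p : ℝ) ^ 2 * ε⁻¹ : ℝ) : ℂ) + ((2 / p : ℝ) : ℂ) * I := by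
      have h1 := hane ε
      simp only [hδ]
      push_cast
      field_simp
      simp only [ha]
      field_simp
      ring_nf
      rw [I_sq]
      ring
    rw [h1, add_re, ofReal_re, re_ofReal_mul, I_re, mul_zero, add_zero]
  have hexp : ∀ z : ℂ, ∀ k : ℤ, cexp (z + 2 * Real.pi * I * k) = cexp z := fun z k => by
    rw [Complex.exp_add, show 2 * (Real.pi : ℂ) * I * k = k * (2 * Real.pi * I) by ring,
      Complex.exp_int_mul_two_pi_mul_I, mul_one]
  have hc1 : Function.Periodic (fun n : ℤ => cexp (2 * Real.pi * I * (n : ℂ) ^ 2 / p)) p := by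
    intro n
    simp only
    rw [← hexp (2 * Real.pi * I * (n : ℂ) ^ 2 / p) (2 * n + p)]
    congr 1
    push_cast
    field_simp
    ring
  have hc2 : Function.Periodic (fun n : ℤ => cexp (-(Real.pi * I * p / 2) * (n : ℂ) ^ 2))
      (2 : ℕ) := by
    intro n
    simp only
    rw [← hexp (-(Real.pi * I * p / 2) * (n : ℂ) ^ 2) (-(p * (n + 1)))]
    congr 1
    push_cast
    ring
  have lim1 := tendsto_tsum_periodic_mul_exp_neg_sq p hc1 ht1
  have lim2 := tendsto_tsum_periodic_mul_exp_neg_sq 2 hc2 ht2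
  have poisson : ∀ ε : ℝ, 0 < ε →
      ∑' n : ℤ, cexp (2 * Real.pi * I * (n : ℂ) ^ 2 / p) * cexp (-Real.pi * ε * n ^ 2) =
      1 / (a ε) ^ (1 / 2 : ℂ) * ∑' n : ℤ, cexp (-(Real.pi * I * p / 2) * (n : ℂ) ^ 2) *
        cexp (-Real.pi * δ ε * n ^ 2) := by
    intro ε hε
    have hre : 0 < (a ε).re := by
      have : a ε = ((ε : ℝ) : ℂ) + ((-(2 / p) : ℝ) : ℂ) * I := by
        simp only [ha]; push_cast; ring
      rw [this]; simpa using hε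
    have := Complex.tsum_exp_neg_mul_int_sq hre
    have e1 : ∀ n : ℤ, cexp (2 * Real.pi * I * (n : ℂ) ^ 2 / p) * cexp (-Real.pi * ε * n ^ 2) =
        cexp (-Real.pi * a ε * (n : ℂ) ^ 2) := fun n => by
      rw [← Complex.exp_add]; simp only [ha]; congr 1; ring
    have e2 : ∀ n : ℤ, cexp (-(Real.pi * I * p / 2) * (n : ℂ) ^ 2) *
        cexp (-Real.pi * δ ε * n ^ 2) = cexp (-Real.pi / a ε * (n : ℂ) ^ 2) := fun n => by
      rw [← Complex.exp_add, div_eq_mul_one_div _ (a ε), hainv]; congr 1; ring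
    simp_rw [e1, e2, this]
  -- w is the ratio of the two normalising factors, 4δ = p²ε · w. It tends to 1, and since p²ε is a
  -- positive real the square root splits with no branch ambiguity.
  set w : ℝ → ℂ := fun ε => -2 * I / (p * a ε) with hw
  have hcont : Tendsto a (𝓝[>] 0) (𝓝 (-2 * I / p)) := by
    have h : Continuous a := by fun_prop
    have h2 := h.tendsto 0
    have h3 : a 0 = -2 * I / p := by simp [ha, neg_div]
    rw [h3] at h2
    exact h2.mono_left nhdsWithin_le_nhds
  have hz0 : (-2 * I / p : ℂ) ≠ 0 := by simp [hpc]
  have hlogz : Complex.log (-2 * I / p) = Real.log (2 / p) + -(Real.pi / 2 * I) := by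
    have : (-2 * I / p : ℂ) = ((2 / p : ℝ) : ℂ) * -I := by push_cast; ring
    rw [this, Complex.log_ofReal_mul (by positivity) (by simp), Complex.log_neg_I]
    ring
  have hslit : (-2 * I / p : ℂ) ∈ slitPlane := by
    right
    have : (-2 * I / p : ℂ) = ((-(2 / p) : ℝ) : ℂ) * I := by push_cast; ring
    rw [this]
    simp [hp]
  have hwlim : Tendsto w (𝓝[>] 0) (𝓝 1) := by
    have := (tendsto_const_nhds (x := (-2 * I / p : ℂ)) (f := 𝓝[>] (0 : ℝ))).div hcont hz0
    rw [div_self hz0] at this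
    refine this.congr fun ε => ?_
    simp only [hw, Pi.div_apply]
    rw [div_div]
  have hcpow1 : Tendsto (fun ε => (a ε) ^ (1 / 2 : ℂ)) (𝓝[>] 0)
      (𝓝 ((-2 * I / p : ℂ) ^ (1 / 2 : ℂ))) := hcont.cpow tendsto_const_nhds hslit
  have hcpow2 : Tendsto (fun ε => (w ε) ^ (1 / 2 : ℂ)) (𝓝[>] 0) (𝓝 1) := by
    have := hwlim.cpow (tendsto_const_nhds (x := (1 / 2 : ℂ))) (by simp)
    simpa using this
  have hscale : ∀ ε : ℝ, 0 < ε → (((2 : ℕ) : ℂ) ^ 2 * δ ε) ^ (1 / 2 : ℂ) =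
      ((p : ℂ) ^ 2 * ε) ^ (1 / 2 : ℂ) * w ε ^ (1 / 2 : ℂ) := by
    intro ε hε
    have h1 := hane ε
    have hx : ((2 : ℕ) : ℂ) ^ 2 * δ ε = (((p : ℝ) ^ 2 * ε : ℝ) : ℂ) * w ε := by
      simp only [hδ, hw]
      push_cast
      field_simp
    have hw0 : w ε ≠ 0 := by
      simp only [hw]
      exact div_ne_zero (by simp) (mul_ne_zero hpc h1)
    have hpos : (0 : ℝ) < (p : ℝ) ^ 2 * ε := by positivity
    have hp2 : (p : ℂ) ^ 2 * ε = (((p : ℝ) ^ 2 * ε : ℝ) : ℂ) := by push_cast; ring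
    have hne : (((p : ℝ) ^ 2 * ε : ℝ) : ℂ) ≠ 0 := by exact_mod_cast hpos.ne'
    rw [hx, hp2, cpow_def_of_ne_zero (mul_ne_zero hne hw0), cpow_def_of_ne_zero hne,
      cpow_def_of_ne_zero hw0, Complex.log_ofReal_mul hpos hw0, ← Complex.exp_add,
      Complex.ofReal_log hpos.le]
    ring_nf
  have lim3 := (lim1.mul hcpow1).mul hcpow2
  have huniq := tendsto_nhds_unique (lim3.congr'
    (f₂ := fun ε => (((2 : ℕ) : ℂ) ^ 2 * δ ε) ^ (1 / 2 : ℂ) *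
      ∑' n : ℤ, cexp (-(Real.pi * I * p / 2) * (n : ℂ) ^ 2) * cexp (-Real.pi * δ ε * n ^ 2)) (by
    filter_upwards [self_mem_nhdsWithin] with ε hε
    have h1 : (a ε) ^ (1 / 2 : ℂ) ≠ 0 := by
      rw [Ne, cpow_eq_zero_iff]; simp [hane ε]
    rw [hscale ε hε, poisson ε hε]
    rw [mul_comm (1 / _) _, ← mul_assoc, mul_assoc _ (1 / _), one_div_mul_cancel h1]
    ring)) lim2
  have hcz : (-2 * I / p : ℂ) ^ (1 / 2 : ℂ) * (Real.sqrt p * ((1 + I) / 2)) = 1 := by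
    have h2p : (0 : ℝ) < 2 / p := by positivity
    have e1 : cexp (-(Real.pi / 4 * I)) = (Real.sqrt 2 / 2 : ℝ) * (1 - I) := by
      have : -(Real.pi / 4 * I : ℂ) = ((-(Real.pi / 4) : ℝ) : ℂ) * I := by push_cast; ring
      rw [this, Complex.exp_mul_I, ← ofReal_cos, ← ofReal_sin, Real.cos_neg, Real.sin_neg,
        Real.cos_pi_div_four, Real.sin_pi_div_four]
      push_cast
      ring
    have e2 : cexp (Real.log (2 / p) / 2) = (Real.sqrt (2 / p) : ℝ) := by
      rw [Real.sqrt_eq_rpow, Real.rpow_def_of_pos h2p]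
      push_cast
      ring_nf
    have e3 : Real.sqrt 2 / 2 * Real.sqrt (2 / p) * Real.sqrt p = 1 := by
      rw [Real.sqrt_div (by norm_num), div_mul_div_comm, Real.mul_self_sqrt (by norm_num)]
      have : Real.sqrt p ≠ 0 := by positivity
      field_simp
    have e4 : ((Real.sqrt 2 / 2 : ℝ) : ℂ) * (Real.sqrt (2 / p) : ℝ) * (Real.sqrt p : ℝ) = 1 := by
      exact_mod_cast e3
    rw [cpow_def_of_ne_zero hz0, hlogz, show ((Real.log (2 / p) : ℝ) + -(Real.pi / 2 * I) : ℂ) *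
      (1 / 2) = Real.log (2 / p) / 2 + -(Real.pi / 4 * I) by ring, Complex.exp_add, e1, e2]
    linear_combination (norm := skip) e4
    ring_nf
    rw [I_sq]
    ring
  have hfin : ∑ r : Fin 2, cexp (-(Real.pi * I * p / 2) * (((r : ℕ) : ℤ) : ℂ) ^ 2) =
      1 + (-I) ^ p := by
    rw [Fin.sum_univ_two]
    simp only [Fin.val_zero, Fin.val_one, Nat.cast_zero, Nat.cast_one, Int.cast_zero, Int.cast_one]
    rw [← Complex.exp_neg_pi_div_two_mul_I, ← Complex.exp_nat_mul]
    norm_num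
    ring_nf
  rw [hfin, mul_one] at huniq
  calc _ = (∑ r : Fin p, cexp (2 * Real.pi * I * ((r : ℤ) : ℂ) ^ 2 / p)) *
        ((-2 * I / p : ℂ) ^ (1 / 2 : ℂ) * (Real.sqrt p * ((1 + I) / 2))) := by rw [hcz, mul_one]
    _ = _ := by rw [← mul_assoc, huniq]; ring

end Theta

theorem one_add_I_mul_one_add_neg_I_pow {n : ℕ} (hn : n % 2 = 1) :
    (1 + Complex.I) / 2 * (1 + (-Complex.I) ^ n) = eps n := by
  have h4 : (-Complex.I) ^ n = (-Complex.I) ^ (n % 4) := by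
    conv_lhs => rw [← Nat.div_add_mod n 4, pow_add, pow_mul]
    simp [Even.neg_pow (show Even 4 by decide)]
  rw [h4, eps]
  have : n % 4 = 1 ∨ n % 4 = 3 := by omega
  rcases this with h | h
  · rw [h, if_pos rfl]
    linear_combination (-1 / 2 : ℂ) * Complex.I_sq
  · rw [h, if_neg (by norm_num)]
    have : (-Complex.I) ^ 3 = Complex.I := by
      linear_combination (-Complex.I) * Complex.I_sq
    rw [this]
    linear_combination (1 / 2 : ℂ) * Complex.I_sq

theorem sum_stdAddChar_sq {N : ℕ} [NeZero N] (hN : N % 2 = 1) :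
    ∑ s : ZMod N, ZMod.stdAddChar (s ^ 2) = (Real.sqrt N : ℂ) * eps N := by
  rw [← one_add_I_mul_one_add_neg_I_pow hN, ← sum_exp_sq_eq N (NeZero.ne N)]
  obtain ⟨n, rfl⟩ := Nat.exists_eq_succ_of_ne_zero (NeZero.ne N)
  refine Finset.sum_congr rfl fun (s : Fin (n + 1)) _ => ?_
  have hs : (s : ZMod (n + 1)) = ((s.val : ℤ) : ZMod (n + 1)) := by
    rw [Int.cast_natCast]
    exact (ZMod.natCast_zmod_val (n := n + 1) s).symm
  conv_lhs => rw [hs, ← Int.cast_pow, ZMod.stdAddChar_coe]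
  push_cast
  rfl

/-- The value x has 1 + (x/p) square roots, so the sum is the Gauss sum of the quadratic character;
rescaling the variable by v pulls out (v/p). -/
theorem sum_stdAddChar_mul_sq {p : ℕ} [Fact p.Prime] (hp : p ≠ 2) {v : ℤ} (hv : ¬ (p : ℤ) ∣ v) :
    ∑ s : ZMod p, ZMod.stdAddChar ((v : ZMod p) * s ^ 2) =
      (legendreSym p v : ℂ) * ((Real.sqrt p : ℂ) * eps p) := by
  have hodd : p % 2 = 1 := (Fact.out : p.Prime).eq_two_or_odd.resolve_left hp
  have hv0 : (v : ZMod p) ≠ 0 := by rwa [Ne, ZMod.intCast_zmod_eq_zero_iff_dvd]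
  have hprim := ZMod.isPrimitive_stdAddChar p
  have key : ∀ u : ZMod p, u ≠ 0 → ∑ s : ZMod p, ZMod.stdAddChar (u * s ^ 2) =
      ∑ x : ZMod p, ((quadraticChar (ZMod p) x : ℤ) : ℂ) * ZMod.stdAddChar (x * u) := by
    intro u hu
    have hz : ∑ x : ZMod p, ZMod.stdAddChar (x * u) = 0 := by
      rw [AddChar.sum_mulShift u hprim, if_neg hu]
      simp
    have h1 : ∑ s : ZMod p, ZMod.stdAddChar (u * s ^ 2) =
        ∑ x : ZMod p, ((quadraticChar (ZMod p) x + 1 : ℤ) : ℂ) * ZMod.stdAddChar (x * u) := by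
      rw [← Finset.sum_fiberwise (s := Finset.univ) (g := fun s : ZMod p => s ^ 2)]
      refine Finset.sum_congr rfl fun x _ => ?_
      rw [← quadraticChar_card_sqrts (by rwa [ZMod.ringChar_zmod_n])]
      rw [Finset.sum_congr rfl (g := fun _ => ZMod.stdAddChar (x * u))]
      · rw [Finset.sum_const, nsmul_eq_mul]
        congr 1
        rw [Int.cast_natCast]
        congr 2
        ext
        simp
      · intro s hs
        rw [← (Finset.mem_filter.1 hs).2, mul_comm]
    rw [h1]
    push_cast
    simp_rw [add_mul, one_mul]
    rw [Finset.sum_add_distrib, hz, add_zero]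
  rw [key _ hv0, ← sum_stdAddChar_sq hodd]
  have h1 := key 1 one_ne_zero
  simp_rw [one_mul, mul_one] at h1
  rw [h1, Finset.mul_sum]
  refine Fintype.sum_equiv (Equiv.mulRight₀ _ hv0) _ _ fun x => ?_
  rw [Equiv.mulRight₀_apply, legendreSym, map_mul (quadraticChar (ZMod p))]
  have h2 : ((quadraticChar (ZMod p) v : ℤ) : ℂ) ^ 2 = 1 := by
    exact_mod_cast quadraticChar_sq_one hv0
  push_cast
  linear_combination (-((quadraticChar (ZMod p) x : ℤ) : ℂ) *
    ZMod.stdAddChar (x * (v : ZMod p))) * h2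

/-! ### Recursions and congruences for R_j -/

theorem exists_one_add_pow_eq (x : ℤ) (n : ℕ) :
    ∃ z : ℤ, (1 + x) ^ n = 1 + n * x + n.choose 2 * x ^ 2 + n.choose 3 * x ^ 3 + x ^ 4 * z := by
  induction n with
  | zero => exact ⟨0, by simp⟩
  | succ n ih =>
    obtain ⟨z, hz⟩ := ih
    refine ⟨n.choose 3 + (1 + x) * z, ?_⟩
    rw [pow_succ, hz, Nat.choose_succ_succ' n 1, Nat.choose_succ_succ' n 2]
    push_cast
    rw [Nat.choose_one_right]
    ring

theorem two_mul_choose_two (n : ℕ) : (2 * (n.choose 2 : ℤ)) = n * (n - 1) := by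
  induction n with
  | zero => simp
  | succ n ih =>
    rw [Nat.choose_succ_succ' n 1, Nat.choose_one_right]
    push_cast
    linear_combination ih

section Odd

variable {p : ℕ} {a : ℤ}

theorem R_succ_spec (ha : IsCoprime a (p : ℤ)) (hp : p.Prime) {j : ℕ} (hj : 1 ≤ j) :
    (1 + R p a j * (p : ℤ) ^ j) ^ p = 1 + R p a (j + 1) * (p : ℤ) ^ (j + 1) := by
  rw [← R_spec p a j ha, ← R_spec p a (j + 1) ha, ← pow_mul]
  congr 1
  obtain ⟨i, rfl⟩ := Nat.exists_eq_add_of_le' hj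
  rw [Nat.totient_prime_pow_succ hp, Nat.totient_prime_pow_succ hp]
  ring

/-- For `p ≥ 5` the binomial expansion determines `R_{j+1}` modulo `p ^ (j + 1)`. -/
theorem two_mul_R_succ_of_five_le (ha : IsCoprime a (p : ℤ)) (hp : p.Prime) (hp5 : 5 ≤ p) {j : ℕ}
    (hj : 1 ≤ j) :
    (p : ℤ) ^ (j + 1) ∣ 2 * (R p a (j + 1) - R p a j) + (p : ℤ) ^ j * R p a j ^ 2 := by
  have hp0 : (p : ℤ) ≠ 0 := by exact_mod_cast hp.ne_zero
  obtain ⟨z, hz⟩ := exists_one_add_pow_eq (R p a j * (p : ℤ) ^ j) p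
  rw [R_succ_spec ha hp hj] at hz
  obtain ⟨w, hw⟩ : (p : ℤ) ∣ p.choose 3 := by
    exact_mod_cast hp.dvd_choose_self (by norm_num) (by omega)
  have h2 := two_mul_choose_two p
  obtain ⟨i, rfl⟩ := Nat.exists_eq_add_of_le' hj
  rw [hw] at hz
  set x := R p a (i + 1)
  set y := R p a (i + 1 + 1)
  refine ⟨x ^ 2 * (p : ℤ) ^ 0 + 2 * w * x ^ 3 * (p : ℤ) ^ i + 2 * x ^ 4 * z * (p : ℤ) ^ (2 * i), ?_⟩
  refine mul_left_cancel₀ (pow_ne_zero (i + 2) hp0) ?_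
  linear_combination (2 : ℤ) * hz + (x ^ 2 * (p : ℤ) ^ (2 * i + 2)) * h2

/-- For p = 3 the binomial expansion of the cube is exact. The cubic term has 3-adic exponent 2j -
1, which falls short of j + 1 precisely at j = 1: this is the origin of the exception 27. -/
theorem R_two_three_succ (ha : IsCoprime a 3) {j : ℕ} (hj : 1 ≤ j) :
    R 3 a (j + 1) = R 3 a j + 3 ^ j * R 3 a j ^ 2 + 3 ^ (2 * j - 1) * R 3 a j ^ 3 := by
  have h := R_succ_spec (p := 3) (by exact_mod_cast ha) Nat.prime_three hj
  push_cast at h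
  obtain ⟨i, rfl⟩ := Nat.exists_eq_add_of_le' hj
  rw [show 2 * (i + 1) - 1 = 2 * i + 1 by omega]
  refine mul_left_cancel₀ (pow_ne_zero (i + 2) (by norm_num : (3 : ℤ) ≠ 0)) ?_
  linear_combination -h

theorem two_mul_R_succ (ha : IsCoprime a (p : ℤ)) (hp : p.Prime) (hp2 : p ≠ 2) {j : ℕ}
    (hj : 1 ≤ j) (h27 : ¬ (p = 3 ∧ j = 1)) :
    (p : ℤ) ^ (j + 1) ∣ 2 * (R p a (j + 1) - R p a j) + (p : ℤ) ^ j * R p a j ^ 2 := by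
  rcases Nat.lt_or_ge p 5 with h | h
  · have : p = 3 := by
      have := hp.two_le
      interval_cases p
      · exact absurd rfl hp2
      · rfl
      · exact absurd hp (by norm_num)
    subst this
    rw [R_two_three_succ (by exact_mod_cast ha) hj]
    obtain ⟨i, rfl⟩ : ∃ i, j = i + 2 := ⟨j - 2, by omega⟩
    rw [show 2 * (i + 2) - 1 = 2 * i + 3 by omega]
    refine ⟨R 3 a (i + 2) ^ 2 + 2 * 3 ^ i * R 3 a (i + 2) ^ 3, ?_⟩
    push_cast
    ring
  · exact two_mul_R_succ_of_five_le ha hp h hj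

theorem R_succ_modEq (ha : IsCoprime a (p : ℤ)) (hp : p.Prime) (hp2 : p ≠ 2) {j : ℕ} (hj : 1 ≤ j) :
    (p : ℤ) ^ j ∣ R p a (j + 1) - R p a j := by
  by_cases h27 : p = 3 ∧ j = 1
  · obtain ⟨rfl, rfl⟩ := h27
    rw [R_two_three_succ (by exact_mod_cast ha) le_rfl]
    exact ⟨R 3 a 1 ^ 2 + R 3 a 1 ^ 3, by push_cast; ring⟩
  · have h := two_mul_R_succ ha hp hp2 hj h27
    have h1 : (p : ℤ) ^ j ∣ 2 * (R p a (j + 1) - R p a j) :=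
      (dvd_add_left (dvd_mul_right _ _)).1 ((pow_dvd_pow _ (Nat.le_succ j)).trans h)
    refine IsCoprime.dvd_of_dvd_mul_left (IsCoprime.pow_left ?_) h1
    exact_mod_cast (Nat.coprime_primes hp Nat.prime_two).2 hp2

theorem R_modEq (ha : IsCoprime a (p : ℤ)) (hp : p.Prime) (hp2 : p ≠ 2) {i j : ℕ} (hi : 1 ≤ i)
    (hij : i ≤ j) : (p : ℤ) ^ i ∣ R p a j - R p a i := by
  induction j, hij using Nat.le_induction with
  | base => simp
  | succ j hj ih =>
    have := R_succ_modEq ha hp hp2 (hi.trans hj)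
    have := dvd_add ((pow_dvd_pow _ hj).trans this) ih
    simpa using this

end Odd

theorem Rtwo_succ {j : ℕ} (hj : 2 ≤ j) : Rtwo (j + 1) = Rtwo j + 2 ^ (j - 1) * Rtwo j ^ 2 := by
  have h1 := Rtwo_spec j hj
  have h2 := Rtwo_spec (j + 1) (by omega)
  obtain ⟨i, rfl⟩ := Nat.exists_eq_add_of_le' hj
  rw [show i + 2 + 1 - 2 = (i + 2 - 2) + 1 by omega, pow_succ 2, pow_mul, h1] at h2
  rw [show i + 2 - 1 = i + 1 by omega]
  refine mul_left_cancel₀ (pow_ne_zero (i + 3) (by norm_num : (2 : ℤ) ≠ 0)) ?_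
  linear_combination -h2

/-- The squaring recursion has correction 2^(j-1) R_j², so one power of 2 is lost compared with odd
p. -/
theorem Rtwo_modEq {i j : ℕ} (hi : 2 ≤ i) (hij : i ≤ j) :
    (2 : ℤ) ^ (i - 1) ∣ Rtwo j - Rtwo i := by
  induction j, hij using Nat.le_induction with
  | base => simp
  | succ j hj ih =>
    rw [Rtwo_succ (hi.trans hj)]
    have : (2 : ℤ) ^ (i - 1) ∣ 2 ^ (j - 1) * Rtwo j ^ 2 :=
      (pow_dvd_pow _ (by omega)).trans (dvd_mul_right _ _)
    have := dvd_add this ih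
    convert! this using 1
    ring

theorem Rtwo_two : Rtwo 2 = 1 := by norm_num [Rtwo]

theorem odd_Rtwo {j : ℕ} (hj : 2 ≤ j) : Odd (Rtwo j) := by
  obtain ⟨k, hk⟩ := Rtwo_modEq le_rfl hj
  rw [Rtwo_two] at hk
  exact ⟨k, by norm_num at hk; linarith⟩

theorem eight_dvd_Rtwo_add_one {j : ℕ} (hj : 4 ≤ j) : (8 : ℤ) ∣ Rtwo j + 1 := by
  have h := Rtwo_modEq (by norm_num : 2 ≤ 4) hj
  -- 5^4 = 625 = 1 + 39 · 16, and 39 ≡ -1 mod 8.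
  have h4 : Rtwo 4 = 39 := by norm_num [Rtwo]
  rw [h4] at h
  norm_num at h
  omega

/-! ### Stationary phase modulo p^m -/

section StationaryPhase

variable {p m : ℕ}

theorem natCast_pow_eq_zero {n : ℕ} (h : m ≤ n) : (p : ZMod (p ^ m)) ^ n = 0 := by
  have : (p : ZMod (p ^ m)) ^ m = ((p ^ m : ℕ) : ZMod (p ^ m)) := by push_cast; rfl
  exact eq_zero_of_zero_dvd (by rw [← ZMod.natCast_self (p ^ m), ← this]; exact pow_dvd_pow _ h)

variable [Fact p.Prime]

theorem pow_mul_intCast_eq_zero_iff {J K : ℕ} (h : J + K = m) (d : ℤ) :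
    (p : ZMod (p ^ m)) ^ J * (d : ZMod (p ^ m)) = 0 ↔ (p : ℤ) ^ K ∣ d := by
  have hp0 : (p : ℤ) ^ J ≠ 0 := pow_ne_zero _ (by exact_mod_cast (Fact.out : p.Prime).ne_zero)
  have : (p : ZMod (p ^ m)) ^ J * (d : ZMod (p ^ m)) = (((p : ℤ) ^ J * d : ℤ) : ZMod (p ^ m)) := by
    push_cast; ring
  rw [this, ZMod.intCast_zmod_eq_zero_iff_dvd, ← h]
  push_cast
  rw [pow_add, mul_dvd_mul_iff_left hp0]

theorem pow_mul_eq_zero_iff {J K : ℕ} (h : J + K = m) (x : ZMod (p ^ m)) :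
    (p : ZMod (p ^ m)) ^ J * x = 0 ↔ (p : ZMod (p ^ m)) ^ K ∣ x := by
  obtain ⟨d, rfl⟩ := ZMod.intCast_surjective x
  rw [pow_mul_intCast_eq_zero_iff h]
  constructor
  · rintro ⟨e, rfl⟩
    exact ⟨e, by push_cast; ring⟩
  · rintro ⟨e, he⟩
    rw [← pow_mul_intCast_eq_zero_iff h, he, ← mul_assoc, ← pow_add, natCast_pow_eq_zero h.ge,
      zero_mul]

theorem card_filter_pow_mul_sub_eq_zero {J : ℕ} (h : J ≤ m) (x₁ : ZMod (p ^ m)) :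
    (Finset.univ.filter fun x : ZMod (p ^ m) => (p : ZMod (p ^ m)) ^ J * (x - x₁) = 0).card =
      p ^ J := by
  obtain ⟨K, hK⟩ := Nat.exists_eq_add_of_le h
  have hp := (Fact.out : p.Prime)
  rw [← Finset.card_range (p ^ J)]
  symm
  refine Finset.card_bij (fun i _ => x₁ + (p : ZMod (p ^ m)) ^ K * (i : ZMod (p ^ m))) ?_ ?_ ?_
  · intro i _
    rw [Finset.mem_filter]
    refine ⟨Finset.mem_univ _, ?_⟩
    rw [add_sub_cancel_left, ← mul_assoc, ← pow_add, natCast_pow_eq_zero hK.le, zero_mul]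
  · intro i hi j hj hij
    have h1 : (p : ZMod (p ^ m)) ^ K * (((i : ℤ) - j : ℤ) : ZMod (p ^ m)) = 0 := by
      push_cast
      rw [mul_sub, sub_eq_zero]
      exact add_left_cancel hij
    rw [pow_mul_intCast_eq_zero_iff (K := J) (by omega)] at h1
    have h2 : j ≡ i [MOD p ^ J] := (Nat.modEq_iff_dvd).2 (by exact_mod_cast h1)
    exact (h2.eq_of_lt_of_lt (Finset.mem_range.1 hj) (Finset.mem_range.1 hi)).symm
  · intro x hx
    rw [Finset.mem_filter, pow_mul_eq_zero_iff hK.symm] at hx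
    obtain ⟨z, hz⟩ := hx.2
    refine ⟨z.val % p ^ J, Finset.mem_range.2 (Nat.mod_lt _ (by have := hp.pos; positivity)), ?_⟩
    have h1 : (p : ZMod (p ^ m)) ^ K * (((z.val % p ^ J : ℕ) : ℤ) - (z.val : ℤ) : ℤ) = 0 := by
      rw [pow_mul_intCast_eq_zero_iff (K := J) (by omega)]
      have := (Nat.modEq_iff_dvd).1 (Nat.mod_modEq z.val (p ^ J)).symm
      exact_mod_cast this
    rw [Int.cast_sub, Int.cast_natCast, Int.cast_natCast, ZMod.natCast_zmod_val, mul_sub,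
      sub_eq_zero] at h1
    rw [h1, ← hz]
    ring

/-- The summand `χ(x) e^{2πix/q}` of the Gauss sum. -/
def gaussTerm {q : ℕ} [NeZero q] (χ : DirichletCharacter ℂ q) (x : ZMod q) : ℂ :=
  χ x * ZMod.stdAddChar x

theorem gaussTerm_mul {q : ℕ} [NeZero q] (χ : DirichletCharacter ℂ q) (x u : ZMod q) :
    gaussTerm χ (x * u) = gaussTerm χ x * (χ u * ZMod.stdAddChar (x * (u - 1))) := by
  have : x * u = x + x * (u - 1) := by ring
  rw [gaussTerm, gaussTerm, map_mul χ]
  rw [show (ZMod.stdAddChar (x * u) : ℂ) = ZMod.stdAddChar x * ZMod.stdAddChar (x * (u - 1)) by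
    rw [← AddChar.map_add_eq_mul, ← this]]
  ring

variable (χ : DirichletCharacter ℂ (p ^ m))

/-- `χ` agrees on `1 + p ^ J ℤ` with the additive character given by the frequency `-x₁`. -/
def IsStationary (J : ℕ) (x₁ : ZMod (p ^ m)) : Prop :=
  ∀ y : ZMod (p ^ m), χ (1 + (p : ZMod (p ^ m)) ^ J * y) =
    ZMod.stdAddChar (-(x₁ * ((p : ZMod (p ^ m)) ^ J * y)))

theorem gaussTerm_mul_one_add {J : ℕ} {x₁ : ZMod (p ^ m)}
    (h : IsStationary χ J x₁) (x y : ZMod (p ^ m)) :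
    gaussTerm χ (x * (1 + (p : ZMod (p ^ m)) ^ J * y)) =
      gaussTerm χ x * ZMod.stdAddChar (y * ((p : ZMod (p ^ m)) ^ J * (x - x₁))) := by
  rw [gaussTerm_mul, h, ← AddChar.map_add_eq_mul]
  ring_nf

/-- Multiplication by the unit 1 + p^J y permutes the residues, so the sum is unchanged for each y;
averaging over y and orthogonality kill every x off the critical set. -/
theorem G_eq_sum_stationary {J : ℕ} {x₁ : ZMod (p ^ m)}
    (h : IsStationary χ J x₁) :
    G χ = ∑ x with (p : ZMod (p ^ m)) ^ J * (x - x₁) = 0, gaussTerm χ x := by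
  have h1 : ∀ y : ZMod (p ^ m), G χ =
      ∑ x, gaussTerm χ x * ZMod.stdAddChar (y * ((p : ZMod (p ^ m)) ^ J * (x - x₁))) := by
    intro y
    -- No bound on J is needed here: χ takes a nonzero value at this element, so it is a unit.
    have hu : IsUnit (1 + (p : ZMod (p ^ m)) ^ J * y) := by
      by_contra hn
      have := h y
      rw [MulChar.map_nonunit χ hn, ZMod.stdAddChar_apply] at this
      exact Circle.coe_ne_zero _ this.symm
    obtain ⟨u, hu⟩ := hu
    simp_rw [← gaussTerm_mul_one_add χ h, ← hu]
    exact (Fintype.sum_equiv (Units.mulRight u) _ _ fun x => rfl).symm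
  have h2 : (Fintype.card (ZMod (p ^ m)) : ℂ) * G χ = Fintype.card (ZMod (p ^ m)) *
      ∑ x with (p : ZMod (p ^ m)) ^ J * (x - x₁) = 0, gaussTerm χ x := by
    calc (Fintype.card (ZMod (p ^ m)) : ℂ) * G χ = ∑ y : ZMod (p ^ m), G χ := by
          rw [Finset.sum_const, nsmul_eq_mul, Finset.card_univ]
      _ = ∑ x, gaussTerm χ x * ∑ y, ZMod.stdAddChar (y * ((p : ZMod (p ^ m)) ^ J * (x - x₁))) := by
          rw [Finset.sum_congr rfl fun y _ => h1 y, Finset.sum_comm]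
          simp_rw [Finset.mul_sum]
      _ = _ := by
          simp_rw [AddChar.sum_mulShift _ (ZMod.isPrimitive_stdAddChar (p ^ m))]
          rw [Finset.mul_sum, Finset.sum_filter]
          refine Finset.sum_congr rfl fun x _ => ?_
          split_ifs
          · rw [mul_comm]
          · simp
  exact mul_left_cancel₀ (by exact_mod_cast Fintype.card_ne_zero) h2

/-- A point of x₀ + p^J ℤ is x₀ times some 1 + p^J y, and at a critical x₀ this multiplication
leaves the summand unchanged. -/
theorem gaussTerm_eq_of_stationary {J K : ℕ} (hJK : J + K = m) {x₁ x₀ x : ZMod (p ^ m)}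
    (h : IsStationary χ J x₁)
    (hx₀ : IsUnit x₀) (h₀ : (p : ZMod (p ^ m)) ^ J * (x₀ - x₁) = 0)
    (hx : (p : ZMod (p ^ m)) ^ K * (x - x₀) = 0) :
    gaussTerm χ x = gaussTerm χ x₀ := by
  rw [pow_mul_eq_zero_iff (by omega : K + J = m)] at hx
  obtain ⟨z, hz⟩ := hx
  obtain ⟨u, rfl⟩ := hx₀
  have : x = u * (1 + (p : ZMod (p ^ m)) ^ J * (↑u⁻¹ * z)) := by
    have : (u : ZMod (p ^ m)) * ↑u⁻¹ = 1 := Units.mul_inv u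
    linear_combination hz - (p ^ J * z) * this
  rw [this, gaussTerm_mul_one_add χ h, h₀, mul_zero, AddChar.map_zero_eq_one, mul_one]

/-- Stationary phase, even exponent: a single class contributes. -/
theorem G_eq_of_even {k : ℕ} (hm : m = k + k) {x₁ : ZMod (p ^ m)} (hx₁ : IsUnit x₁)
    (h : IsStationary χ k x₁) :
    G χ = p ^ k * gaussTerm χ x₁ := by
  rw [G_eq_sum_stationary χ h, Finset.sum_congr rfl (g := fun _ => gaussTerm χ x₁),
    Finset.sum_const, card_filter_pow_mul_sub_eq_zero (by omega), nsmul_eq_mul]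
  · push_cast; rfl
  · intro x hx
    exact gaussTerm_eq_of_stationary χ hm.symm h hx₁ (by simp) (Finset.mem_filter.1 hx).2

theorem one_add_pow_modEq (R : ℤ) (t : ℕ) (q : ℤ) :
    ∃ z, (1 + R * q) ^ t = 1 + t * (R * q) + q ^ 2 * z := by
  obtain ⟨z, hz⟩ := exists_one_add_pow_eq (R * q) t
  exact ⟨t.choose 2 * R ^ 2 + t.choose 3 * R ^ 3 * q + R ^ 4 * q ^ 2 * z, by rw [hz]; ring⟩

/-- Stationary phase, odd exponent: `p` classes contribute, and they are swept out by the powers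
of `1 + R p ^ k`. -/
theorem G_eq_of_odd {k : ℕ} (hk : 1 ≤ k) (hm : m = k + 1 + k) {x₁ : ZMod (p ^ m)}
    (hx₁ : IsUnit x₁)
    (h : IsStationary χ (k + 1) x₁)
    {R : ℤ} (hR : ¬ (p : ℤ) ∣ R) :
    G χ = p ^ k * ∑ t ∈ Finset.range p,
      gaussTerm χ (x₁ * (1 + R * (p : ZMod (p ^ m)) ^ k) ^ t) := by
  classical
  have hp := (Fact.out : p.Prime)
  have hpZ : Prime (p : ℤ) := Nat.prime_iff_prime_int.1 hp
  set u : ZMod (p ^ m) := 1 + R * p ^ k with hu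
  have huu : IsUnit u := by
    have : IsNilpotent ((R : ZMod (p ^ m)) * p ^ k) :=
      ⟨m, by rw [mul_pow, ← pow_mul, natCast_pow_eq_zero (by nlinarith), mul_zero]⟩
    exact this.isUnit_one_add
  have hpow : ∀ t : ℕ, ∃ z : ZMod (p ^ m), u ^ t = 1 + t * (R * p ^ k) + p ^ (k + 1) * z := by
    intro t
    obtain ⟨z, hz⟩ := one_add_pow_modEq R t ((p : ℤ) ^ k)
    have := congrArg (Int.cast : ℤ → ZMod (p ^ m)) hz
    push_cast at this
    obtain ⟨i, rfl⟩ := Nat.exists_eq_add_of_le' hk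
    refine ⟨p ^ i * z, ?_⟩
    rw [hu, this]
    ring
  have hz0 : ∀ z : ZMod (p ^ m), (p : ZMod (p ^ m)) ^ k * (p ^ (k + 1) * z) = 0 := fun z => by
    rw [← mul_assoc, ← pow_add, natCast_pow_eq_zero (by omega), zero_mul]
  have hz1 : ∀ z : ZMod (p ^ m), (p : ZMod (p ^ m)) ^ (k + 1) * (p ^ k * z) = 0 := fun z => by
    rw [← mul_assoc, ← pow_add, natCast_pow_eq_zero (by omega), zero_mul]
  have hstat : ∀ t : ℕ, (p : ZMod (p ^ m)) ^ (k + 1) * (x₁ * u ^ t - x₁) = 0 := by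
    intro t
    obtain ⟨z, hz⟩ := hpow t
    rw [hz]
    linear_combination hz1 (x₁ * t * R) + hz1 (x₁ * p * z)
  set A : Finset (ZMod (p ^ m)) :=
    Finset.univ.filter fun x => (p : ZMod (p ^ m)) ^ (k + 1) * (x - x₁) = 0 with hA
  set B : ℕ → Finset (ZMod (p ^ m)) := fun t =>
    Finset.univ.filter fun x => (p : ZMod (p ^ m)) ^ k * (x - x₁ * u ^ t) = 0 with hB
  have hdisj : (Finset.range p : Set ℕ).PairwiseDisjoint B := by
    intro s hs t ht hst
    rw [Function.onFun, Finset.disjoint_left]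
    intro x hxs hxt
    have h1 := (Finset.mem_filter.1 hxs).2
    have h2 := (Finset.mem_filter.1 hxt).2
    obtain ⟨z, hz⟩ := hpow s
    obtain ⟨w, hw⟩ := hpow t
    obtain ⟨v, rfl⟩ := hx₁
    have hv : (v : ZMod (p ^ m)) * ↑v⁻¹ = 1 := Units.mul_inv v
    -- Modulo p^(2k+1), p^k (u^s - u^t) only sees the linear term p^(2k) (s - t) R, so a common
    -- element forces s ≡ t mod p.
    have h3 : (p : ZMod (p ^ m)) ^ (k + k) * ((((s : ℤ) - t) * R : ℤ) : ZMod (p ^ m)) = 0 := by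
      rw [hz] at h1
      rw [hw] at h2
      push_cast
      linear_combination (↑v⁻¹) * (h2 - h1) - hz0 z + hz0 w -
        (p ^ k * (s * (R * p ^ k) + p ^ (k + 1) * z) -
          p ^ k * (t * (R * p ^ k) + p ^ (k + 1) * w)) * hv
    rw [pow_mul_intCast_eq_zero_iff (K := 1) (by omega), pow_one] at h3
    have h4 : (p : ℤ) ∣ (s : ℤ) - t := (hpZ.dvd_or_dvd h3).resolve_right hR
    have h5 : t ≡ s [MOD p] := Nat.modEq_iff_dvd.2 h4
    have hs' : s < p := by simpa using hs
    have ht' : t < p := by simpa using ht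
    exact hst (h5.eq_of_lt_of_lt ht' hs').symm
  -- The inclusion is an equality by counting: p disjoint sets of size p^k inside one of size
  -- p^(k+1).
  have hAB : (Finset.range p).biUnion B = A := by
    refine Finset.eq_of_subset_of_card_le ?_ ?_
    · intro x hx
      obtain ⟨t, _, ht⟩ := Finset.mem_biUnion.1 hx
      have h1 := (Finset.mem_filter.1 ht).2
      refine Finset.mem_filter.2 ⟨Finset.mem_univ _, ?_⟩
      linear_combination p * h1 + hstat t
    · rw [Finset.card_biUnion hdisj, Finset.sum_congr rfl (g := fun _ => p ^ k)
        (fun t _ => card_filter_pow_mul_sub_eq_zero (by omega) _), Finset.sum_const,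
        Finset.card_range, card_filter_pow_mul_sub_eq_zero (by omega), smul_eq_mul, pow_succ']
  rw [G_eq_sum_stationary χ h, ← hA, ← hAB, Finset.sum_biUnion hdisj, Finset.mul_sum]
  refine Finset.sum_congr rfl fun t _ => ?_
  rw [Finset.sum_congr rfl (g := fun _ => gaussTerm χ (x₁ * u ^ t)), Finset.sum_const,
    card_filter_pow_mul_sub_eq_zero (by omega), nsmul_eq_mul]
  · push_cast; rfl
  · intro x hx
    exact gaussTerm_eq_of_stationary χ hm.symm h (hx₁.mul (huu.pow t)) (hstat t)
      (Finset.mem_filter.1 hx).2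

/-- On `1 + p ^ J ℤ`, `2 J ≥ m`, a character is determined by one value. -/
theorem isStationary_of_apply_eq {J : ℕ} (hJ : m ≤ 2 * J) {R c : ℤ} (hR : ¬ (p : ℤ) ∣ R)
    (hχ : χ (1 + R * (p : ZMod (p ^ m)) ^ J) =
      ZMod.stdAddChar ((c : ZMod (p ^ m)) * (p : ZMod (p ^ m)) ^ J)) {x₁ : ZMod (p ^ m)}
    (hx₁ : (p : ZMod (p ^ m)) ^ J * (x₁ * R + c) = 0) :
    IsStationary χ J x₁ := by
  intro y
  have hpow : ∀ s : ℕ, (1 + R * p ^ J : ZMod (p ^ m)) ^ s = 1 + p ^ J * (R * s) := by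
    intro s
    obtain ⟨z, hz⟩ := one_add_pow_modEq R s ((p : ℤ) ^ J)
    have := congrArg (Int.cast : ℤ → ZMod (p ^ m)) hz
    push_cast at this
    rw [this, ← pow_mul, mul_comm J 2, natCast_pow_eq_zero hJ]
    ring
  have hR' : IsUnit (R : ZMod (p ^ m)) := by
    rw [ZMod.coe_int_isUnit_iff_isCoprime]
    push_cast
    exact ((Nat.prime_iff_prime_int.1 (Fact.out : p.Prime)).coprime_iff_not_dvd.2 hR).pow_left
  obtain ⟨v, hv⟩ := hR'
  -- As R is a unit, every 1 + p^J y is a power of 1 + R p^J.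
  have hs : y = R * (((↑v⁻¹ * y).val : ℕ) : ZMod (p ^ m)) := by
    rw [ZMod.natCast_zmod_val, ← hv, ← mul_assoc, Units.mul_inv, one_mul]
  set s := ((↑v⁻¹ : ZMod (p ^ m)) * y).val
  rw [hs, ← hpow, map_pow, hχ, ← AddChar.map_nsmul_eq_pow, nsmul_eq_mul]
  congr 1
  linear_combination s * hx₁

end StationaryPhase

/-! ### Changing the modulus of additive characters; powers p^(m/2) -/

theorem pow_eq_stdAddChar_of_isIndex {N : ℕ} {z : ℂ} {c : ℕ} (h : IsIndex N z c) {n q d : ℕ}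
    [NeZero q] (hN : N ≠ 0) (hnd : n * q = d * N) :
    z ^ n = ZMod.stdAddChar ((c : ZMod q) * (d : ZMod q)) := by
  have e : ((c : ZMod q) * (d : ZMod q)) = (((c * d : ℕ) : ℤ) : ZMod q) := by push_cast; rfl
  rw [e, ZMod.stdAddChar_coe, h.2.2, ← Complex.exp_nat_mul]
  congr 1
  have hN' : (N : ℂ) ≠ 0 := by exact_mod_cast hN
  have hq' : (q : ℂ) ≠ 0 := by exact_mod_cast NeZero.ne q
  have hnd' : (n : ℂ) * q = d * N := by exact_mod_cast hnd
  push_cast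
  field_simp
  linear_combination c * hnd'

theorem stdAddChar_mul_left {q d e : ℕ} [NeZero q] [NeZero e] (h : q = d * e) (y : ℤ) :
    ZMod.stdAddChar (((d * y : ℤ)) : ZMod q) = ZMod.stdAddChar (y : ZMod e) := by
  subst h
  rw [ZMod.stdAddChar_coe, ZMod.stdAddChar_coe]
  congr 1
  have hd : (d : ℂ) ≠ 0 := by
    have := left_ne_zero_of_mul (NeZero.ne (d * e))
    exact_mod_cast this
  have he : (e : ℂ) ≠ 0 := by exact_mod_cast NeZero.ne e
  push_cast
  field_simp

theorem sum_range_natCast {M : Type*} [AddCommMonoid M] (N : ℕ) [NeZero N] (f : ZMod N → M) :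
    ∑ t ∈ Finset.range N, f t = ∑ s : ZMod N, f s := by
  refine Finset.sum_bij (fun t _ => (t : ZMod N)) (fun _ _ => Finset.mem_univ _) ?_ ?_ ?_
  · intro s hs t ht hst
    exact ((ZMod.natCast_eq_natCast_iff _ _ _).1 hst).eq_of_lt_of_lt (Finset.mem_range.1 hs)
      (Finset.mem_range.1 ht)
  · intro s _
    exact ⟨s.val, Finset.mem_range.2 (ZMod.val_lt s), ZMod.natCast_zmod_val s⟩
  · intros; rfl

theorem natCast_rpow_half_even {p m k : ℕ} (hm : m = k + k) :
    (((p : ℝ) ^ ((m : ℝ) / 2) : ℝ) : ℂ) = (p : ℂ) ^ k := by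
  have : (m : ℝ) / 2 = (k : ℕ) := by rw [hm]; push_cast; ring
  rw [this, Real.rpow_natCast]
  push_cast
  rfl

theorem natCast_rpow_half_odd {p m k : ℕ} (hp : 0 < p) (hm : m = k + 1 + k) :
    (((p : ℝ) ^ ((m : ℝ) / 2) : ℝ) : ℂ) = (p : ℂ) ^ k * (Real.sqrt p : ℝ) := by
  have : (m : ℝ) / 2 = (k : ℕ) + 1 / 2 := by rw [hm]; push_cast; ring
  rw [this, Real.rpow_add (by exact_mod_cast hp), Real.rpow_natCast, Real.sqrt_eq_rpow]
  push_cast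
  rfl

theorem isUnit_one_add_pow_mul {p m J : ℕ} (hJ : J ≠ 0) (y : ZMod (p ^ m)) :
    IsUnit (1 + (p : ZMod (p ^ m)) ^ J * y) := by
  have : IsNilpotent ((p : ZMod (p ^ m)) ^ J * y) :=
    ⟨m, by
      rw [mul_pow, ← pow_mul, natCast_pow_eq_zero (Nat.le_mul_of_pos_left m (by omega)), zero_mul]⟩
  exact this.isUnit_one_add

/-! ### Primitivity and the vanishing for imprimitive characters -/

section Primitive

variable {p m : ℕ} [Fact p.Prime] (χ : DirichletCharacter ℂ (p ^ m))

/-- Both sides say that χ is trivial on the kernel 1 + p^(m-1) ℤ of reduction mod p^(m-1). -/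
theorem factorsThrough_iff_isStationary (hm : 2 ≤ m) :
    χ.FactorsThrough (p ^ (m - 1)) ↔ IsStationary χ (m - 1) 0 := by
  have hd : p ^ (m - 1) ∣ p ^ m := pow_dvd_pow _ (by omega)
  rw [DirichletCharacter.factorsThrough_iff_ker_unitsMap hd]
  constructor
  · intro h y
    obtain ⟨u, hu⟩ := isUnit_one_add_pow_mul (p := p) (m := m) (J := m - 1) (by omega) y
    have h1 : u ∈ (ZMod.unitsMap hd).ker := by
      rw [MonoidHom.mem_ker, ← Units.val_inj, ZMod.unitsMap_def, Units.coe_map, hu,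
        MonoidHom.coe_coe, map_add, map_mul, map_pow, map_natCast, natCast_pow_eq_zero le_rfl,
        map_one, zero_mul, add_zero, Units.val_one]
    have h2 := h h1
    rw [MonoidHom.mem_ker, ← Units.val_inj, MulChar.coe_toUnitHom] at h2
    rw [← hu, h2]
    simp
  · intro h u hu
    rw [MonoidHom.mem_ker, ← Units.val_inj, ZMod.unitsMap_def, Units.coe_map] at hu
    rw [MonoidHom.mem_ker, ← Units.val_inj, MulChar.coe_toUnitHom]
    obtain ⟨d, hd'⟩ := ZMod.intCast_surjective (u : ZMod (p ^ m))
    rw [← hd'] at hu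
    have h1 : ((d : ℤ) : ZMod (p ^ (m - 1))) = ((1 : ℤ) : ZMod (p ^ (m - 1))) := by simpa using hu
    obtain ⟨e, he⟩ := (ZMod.intCast_eq_intCast_iff_dvd_sub _ _ _).1 h1.symm
    have h2 : (u : ZMod (p ^ m)) = 1 + (p : ZMod (p ^ m)) ^ (m - 1) * (e : ZMod (p ^ m)) := by
      rw [← hd', show d = 1 + (p : ℤ) ^ (m - 1) * e by push_cast at he; linarith]
      push_cast
      rfl
    rw [h2, h e]
    simp

theorem not_isStationary_of_isPrimitive (hm : 2 ≤ m) (hχ : χ.IsPrimitive) :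
    ¬ IsStationary χ (m - 1) 0 := by
  rw [← factorsThrough_iff_isStationary χ hm]
  intro h
  have h1 : χ.conductor ≤ p ^ (m - 1) := Nat.sInf_le h
  rw [(DirichletCharacter.isPrimitive_def χ).1 hχ] at h1
  have := (Nat.pow_le_pow_iff_right (Fact.out : p.Prime).one_lt).1 h1
  omega

theorem G_eq_zero_of_not_isPrimitive (hm : 2 ≤ m) (hχ : ¬ χ.IsPrimitive) : G χ = 0 := by
  have hp := (Fact.out : p.Prime)
  have hst : IsStationary χ (m - 1) 0 := by
    rw [← factorsThrough_iff_isStationary χ hm]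
    obtain ⟨i, hi, hc⟩ := (Nat.dvd_prime_pow hp).1 χ.conductor_dvd_level
    have him : i ≠ m := fun h => hχ ((DirichletCharacter.isPrimitive_def χ).2 (by rw [hc, h]))
    refine DirichletCharacter.FactorsThrough.mono χ χ.factorsThrough_conductor ?_ ?_
    · rw [hc]; exact pow_dvd_pow _ (by omega)
    · exact pow_dvd_pow _ (by omega)
  rw [G_eq_sum_stationary χ hst]
  refine Finset.sum_eq_zero fun x hx => ?_
  have h1 := (Finset.mem_filter.1 hx).2
  rw [sub_zero, pow_mul_eq_zero_iff (K := 1) (by omega), pow_one] at h1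
  have : ¬ IsUnit x := by
    intro hx
    have h2 : IsUnit (p : ZMod (p ^ m)) := isUnit_of_dvd_unit h1 hx
    have h3 := h2.pow m
    rw [natCast_pow_eq_zero le_rfl, isUnit_zero_iff] at h3
    have : Fact (1 < p ^ m) := ⟨Nat.one_lt_pow (by omega) hp.one_lt⟩
    exact zero_ne_one h3
  rw [gaussTerm, MulChar.map_nonunit χ this, zero_mul]

/-- If p divided c, then χ would be trivial on a generator of 1 + p^(m-1) ℤ, hence on the whole
subgroup. -/
theorem not_dvd_of_isPrimitive (hm : 2 ≤ m) (hχ : χ.IsPrimitive) {R : ℤ} {c : ℕ}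
    (hR : ¬ (p : ℤ) ∣ R) (h : χ (1 + R * (p : ZMod (p ^ m)) ^ (m - 1)) =
      ZMod.stdAddChar ((c : ZMod (p ^ m)) * (p : ZMod (p ^ m)) ^ (m - 1))) : ¬ p ∣ c := by
  rintro ⟨d, rfl⟩
  refine not_isStationary_of_isPrimitive χ hm hχ
    (isStationary_of_apply_eq χ (by omega) (c := ((p * d : ℕ) : ℤ)) hR (by rw [h]; simp) ?_)
  rw [zero_mul, zero_add, pow_mul_intCast_eq_zero_iff (K := 1) (by omega), pow_one]
  exact ⟨d, by push_cast; rfl⟩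

end Primitive

/-! ### Odd primes -/

section Odd

variable {p m : ℕ} [Fact p.Prime] {a : ℤ}

theorem IsPrimitiveRootMod.isCoprime (hm : 1 ≤ m) (ha : IsPrimitiveRootMod a (p ^ m)) :
    IsCoprime a (p : ℤ) := by
  have h1 : IsOfFinOrder (a : ZMod (p ^ m)) := by
    rw [← orderOf_pos_iff, ha, Nat.totient_pos]
    exact pow_pos (Fact.out : p.Prime).pos m
  have h2 := h1.isUnit
  rw [ZMod.coe_int_isUnit_iff_isCoprime] at h2
  push_cast at h2
  exact ((IsCoprime.pow_left_iff (by omega)).1 h2).symm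

/-- If p divided R_(m-1), the order of a would divide φ(p^(m-1)), which is too small; all R_j agree
mod p. -/
theorem IsPrimitiveRootMod.not_dvd_R (hp2 : p ≠ 2) (hm : 2 ≤ m)
    (ha : IsPrimitiveRootMod a (p ^ m)) {j : ℕ} (hj : 1 ≤ j) : ¬ (p : ℤ) ∣ R p a j := by
  have hp := (Fact.out : p.Prime)
  have hcop := ha.isCoprime (by omega)
  have h0 : ¬ (p : ℤ) ∣ R p a (m - 1) := by
    rintro ⟨d, hd⟩
    have h1 := R_spec p a (m - 1) hcop
    rw [hd] at h1
    have h2 : (a : ZMod (p ^ m)) ^ Nat.totient (p ^ (m - 1)) = 1 := by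
      have h3 := congrArg (Int.cast : ℤ → ZMod (p ^ m)) h1
      push_cast at h3
      rw [h3]
      have h4 : (p : ZMod (p ^ m)) * p ^ (m - 1) = 0 := by
        rw [← pow_succ', natCast_pow_eq_zero (by omega)]
      linear_combination d * h4
    have h3 := orderOf_dvd_of_pow_eq_one h2
    rw [ha] at h3
    have h4 := Nat.le_of_dvd (Nat.totient_pos.2 (pow_pos hp.pos _)) h3
    rw [Nat.totient_prime_pow hp (by omega), Nat.totient_prime_pow hp (by omega)] at h4
    have h5 : p ^ (m - 1 - 1) < p ^ (m - 1) := Nat.pow_lt_pow_right hp.one_lt (by omega)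
    have h6 : 0 < p - 1 := by have := hp.two_le; omega
    exact absurd h4 (not_le.2 (Nat.mul_lt_mul_of_pos_right h5 h6))
  have key : ∀ i, 1 ≤ i → (p : ℤ) ∣ R p a i - R p a 1 := fun i hi => by
    simpa using R_modEq hcop hp hp2 le_rfl hi
  intro h
  refine h0 ?_
  have := dvd_add (dvd_sub (key (m - 1) (by omega)) (key j hj)) h
  ring_nf at this
  exact this

variable (χ : DirichletCharacter ℂ (p ^ m))

/-- Apply χ to a^φ(p^j) = 1 + R_j p^j and use φ(p^j)/φ(p^m) = p^j/p^m. -/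
theorem apply_one_add_R (hcop : IsCoprime a (p : ℤ)) {c : ℕ}
    (hc : IsIndex (Nat.totient (p ^ m)) (χ a) c) (hm : 1 ≤ m) {j : ℕ} (hj : 1 ≤ j) :
    χ (1 + R p a j * (p : ZMod (p ^ m)) ^ j) =
      ZMod.stdAddChar ((c : ZMod (p ^ m)) * (p : ZMod (p ^ m)) ^ j) := by
  have hp := (Fact.out : p.Prime)
  have h1 := congrArg (Int.cast : ℤ → ZMod (p ^ m)) (R_spec p a j hcop)
  push_cast at h1
  rw [← h1, map_pow, pow_eq_stdAddChar_of_isIndex hc (q := p ^ m) (d := p ^ j)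
    (Nat.totient_pos.2 (pow_pos hp.pos _)).ne']
  · push_cast; rfl
  · obtain ⟨i, rfl⟩ := Nat.exists_eq_add_of_le' hj
    obtain ⟨n, rfl⟩ := Nat.exists_eq_add_of_le' hm
    rw [Nat.totient_prime_pow_succ hp, Nat.totient_prime_pow_succ hp]
    ring

theorem isUnit_intCast_of_not_dvd {d : ℤ} (hd : ¬ (p : ℤ) ∣ d) : IsUnit (d : ZMod (p ^ m)) := by
  rw [ZMod.coe_int_isUnit_iff_isCoprime]
  push_cast
  exact ((Nat.prime_iff_prime_int.1 (Fact.out : p.Prime)).coprime_iff_not_dvd.2 hd).pow_left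

theorem neg_mul_inv_mul_cancel {d : ℤ} (hd : ¬ (p : ℤ) ∣ d) (c : ZMod (p ^ m)) :
    -c * (d : ZMod (p ^ m))⁻¹ * d + c = 0 := by
  have := ZMod.inv_mul_of_unit _ (isUnit_intCast_of_not_dvd (m := m) hd)
  linear_combination (-c) * this

theorem isUnit_neg_mul_inv {c : ℕ} {d : ℤ} (hc : ¬ p ∣ c) (hd : ¬ (p : ℤ) ∣ d) :
    IsUnit (-(c : ZMod (p ^ m)) * (d : ZMod (p ^ m))⁻¹) := by
  have h := neg_mul_inv_mul_cancel (m := m) hd c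
  have h1 : IsUnit (c : ZMod (p ^ m)) := by
    have := isUnit_intCast_of_not_dvd (p := p) (m := m) (d := (c : ℤ)) (by exact_mod_cast hc)
    simpa using this
  refine isUnit_of_mul_isUnit_left (y := (d : ZMod (p ^ m))) ?_
  rw [eq_neg_of_add_eq_zero_left h]
  exact h1.neg

end Odd

/-- The phase of `gaussTerm χ (x₁ (1 + R p ^ k) ^ t)` is quadratic in `t`, up to an error measured
by the failure `E` of `2 (R_j - R) + p ^ k R ^ 2` to vanish. -/
theorem dvd_two_mul_phase_sub {p c X R R' v E : ℤ} {k : ℕ} (hk : 1 ≤ k)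
    (hX : p ^ (k + 1) ∣ c + X * R')
    (hE : p ^ (k + 1) ∣ 2 * (R' - R) + p ^ k * R ^ 2 - E)
    (hv : 2 * v = (p + 1) * (X * R ^ 2)) (t : ℕ) :
    p ^ (k + 1 + k) ∣ 2 * (c * t * p ^ k + X * ((1 + R * p ^ k) ^ t - 1) -
        p ^ (k + k) * v * t ^ 2) +
      p ^ k * (t * X * E) := by
  obtain ⟨y, hy⟩ := hX
  obtain ⟨z, hz⟩ := hE
  obtain ⟨w, hw⟩ := exists_one_add_pow_eq (R * p ^ k) t
  have h2 := two_mul_choose_two t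
  obtain ⟨i, rfl⟩ := Nat.exists_eq_add_of_le' hk
  refine ⟨2 * t * y - t * X * z - X * R ^ 2 * t ^ 2 + 2 * X * (t.choose 3 * R ^ 3 * p ^ i +
    R ^ 4 * w * p ^ (2 * i + 1)), ?_⟩
  rw [hw]
  -- The term linear in t from 2 · choose(t, 2) = t² - t cancels against 2(R - R') ≡ p^k R² - E;
  -- cubic and higher binomial terms vanish because 3k ≥ 2k + 1.
  linear_combination (2 * t * p ^ (i + 1)) * hy - (X * t * p ^ (i + 1)) * hz -
    (p ^ (2 * i + 2) * t ^ 2) * hv + (X * R ^ 2 * p ^ (2 * i + 2)) * h2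

section Odd

variable {p m : ℕ} [Fact p.Prime] {a : ℤ} (χ : DirichletCharacter ℂ (p ^ m))

theorem gaussTerm_mul_pow {x₁ : ZMod (p ^ m)} {k : ℕ} {R : ℤ} {c : ℕ}
    (h : χ (1 + (R : ZMod (p ^ m)) * (p : ZMod (p ^ m)) ^ k) =
      ZMod.stdAddChar ((c : ZMod (p ^ m)) * (p : ZMod (p ^ m)) ^ k)) (t : ℕ) :
    gaussTerm χ (x₁ * (1 + (R : ZMod (p ^ m)) * (p : ZMod (p ^ m)) ^ k) ^ t) = gaussTerm χ x₁ *
      ZMod.stdAddChar ((c : ZMod (p ^ m)) * (t : ZMod (p ^ m)) * (p : ZMod (p ^ m)) ^ k +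
        x₁ * ((1 + (R : ZMod (p ^ m)) * (p : ZMod (p ^ m)) ^ k) ^ t - 1)) := by
  rw [gaussTerm_mul, map_pow, h, ← AddChar.map_nsmul_eq_pow, ← AddChar.map_add_eq_mul]
  congr 2
  rw [nsmul_eq_mul]
  ring

theorem G_eq_of_odd_prime (hp2 : p ≠ 2) (hm : 2 ≤ m) (hχ : χ.IsPrimitive) {c j : ℕ}
    (ha : IsPrimitiveRootMod a (p ^ m)) (hc : IsIndex (Nat.totient (p ^ m)) (χ a) c)
    (hj : ⌈(m : ℚ) / 2⌉₊ ≤ j) :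
    G χ = (((p : ℝ) ^ ((m : ℝ) / 2) : ℝ) : ℂ) *
      gaussTerm χ (-(c : ZMod (p ^ m)) * (R p a j : ZMod (p ^ m))⁻¹) *
      ((legendreSym p (-2 * r p a * c) : ℤ) : ℂ) ^ m * eps (p ^ m) *
      (if p ^ m = 27 then ZMod.stdAddChar ((-(r p a * c) : ℤ) : ZMod 3) else 1) := by
  have hp := (Fact.out : p.Prime)
  have hpZ : Prime (p : ℤ) := Nat.prime_iff_prime_int.1 hp
  have hodd : p % 2 = 1 := hp.eq_two_or_odd.resolve_left hp2
  have h2 : ¬ (p : ℤ) ∣ 2 := by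
    intro h
    have : p ∣ 2 := by exact_mod_cast h
    exact hp2 ((Nat.prime_dvd_prime_iff_eq hp Nat.prime_two).1 this)
  have hcop := ha.isCoprime (by omega)
  have hR : ∀ {i}, 1 ≤ i → ¬ (p : ℤ) ∣ R p a i := fun hi => ha.not_dvd_R hp2 hm hi
  have happ : ∀ {i}, 1 ≤ i → _ := fun hi => apply_one_add_R χ hcop hc (by omega) hi
  have hcp : ¬ p ∣ c :=
    not_dvd_of_isPrimitive χ hm hχ (hR (by omega)) (happ (i := m - 1) (by omega))
  have hjm : m ≤ 2 * j := by
    have h := (Nat.le_ceil _).trans (Nat.cast_le (α := ℚ).2 hj)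
    rw [div_le_iff₀ (by norm_num)] at h
    have : m ≤ j * 2 := by exact_mod_cast h
    omega
  have hj1 : 1 ≤ j := by omega
  have hlegne : ((-2 * r p a * c : ℤ) : ZMod p) ≠ 0 := by
    rw [Ne, ZMod.intCast_zmod_eq_zero_iff_dvd, hpZ.dvd_mul, hpZ.dvd_mul, dvd_neg, r_eq_R_one]
    rintro ((h | h) | h)
    · exact h2 h
    · exact hR le_rfl h
    · exact hcp (by exact_mod_cast h)
  have hleg2 : ((legendreSym p (-2 * r p a * c) : ℤ) : ℂ) ^ 2 = 1 := by
    exact_mod_cast legendreSym.sq_one p hlegne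
  set x₁ : ZMod (p ^ m) := -(c : ZMod (p ^ m)) * (R p a j : ZMod (p ^ m))⁻¹ with hx₁
  have hx₁u : IsUnit x₁ := isUnit_neg_mul_inv hcp (hR hj1)
  have hx₁c : x₁ * (R p a j : ZMod (p ^ m)) + c = 0 := neg_mul_inv_mul_cancel (hR hj1) _
  have hst : ∀ {J K : ℕ}, J + K = m → K ≤ J → 1 ≤ J → J ≤ j → IsStationary χ J x₁ := by
    intro J K hJK hKJ hJ hJj
    refine isStationary_of_apply_eq χ (by omega) (c := (c : ℤ)) (hR hJ) ?_ ?_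
    · rw [happ hJ]; push_cast; rfl
    · have h1 : (p : ZMod (p ^ m)) ^ J * ((R p a j - R p a J : ℤ) : ZMod (p ^ m)) = 0 := by
        rw [pow_mul_intCast_eq_zero_iff hJK]
        exact (pow_dvd_pow _ hKJ).trans (R_modEq hcop hp hp2 hJ hJj)
      push_cast at h1 ⊢
      linear_combination (p : ZMod (p ^ m)) ^ J * hx₁c - x₁ * h1
  rcases Nat.even_or_odd' m with ⟨k, hk | hk⟩
  · -- even exponent
    have hk' : m = k + k := by omega
    have h27 : p ^ m ≠ 27 := by
      intro h
      have h3 : (p ^ k) * (p ^ k) = 27 := by rw [← pow_add, ← hk', h]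
      have h4 : p ^ k < 6 := by nlinarith
      interval_cases h5 : p ^ k <;> omega
    have heps : eps (p ^ m) = 1 := by
      have : p ^ m % 4 = 1 := by
        rw [hk, pow_mul, Nat.pow_mod]
        have : p ^ 2 % 4 = 1 := by
          have : p % 4 = 1 ∨ p % 4 = 3 := by omega
          rcases this with h | h <;> simp [Nat.pow_mod, h]
        rw [this, one_pow, Nat.one_mod]
      rw [eps, if_pos this]
    have hleg : ((legendreSym p (-2 * r p a * c) : ℤ) : ℂ) ^ m = 1 := by
      rw [hk, pow_mul, hleg2, one_pow]
    rw [if_neg h27, heps, hleg, mul_one, mul_one, mul_one, natCast_rpow_half_even hk']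
    exact G_eq_of_even χ hk' hx₁u (hst hk'.symm le_rfl (by omega) (by omega))
  · -- odd exponent
    have hk' : m = k + 1 + k := by omega
    have hk1 : 1 ≤ k := by omega
    have heps : eps (p ^ m) = eps p := by
      have : p ^ m % 4 = p % 4 := by
        rw [hk, pow_succ, pow_mul, Nat.mul_mod, Nat.pow_mod]
        have : p ^ 2 % 4 = 1 := by
          have : p % 4 = 1 ∨ p % 4 = 3 := by omega
          rcases this with h | h <;> simp [Nat.pow_mod, h]
        rw [this, one_pow, Nat.one_mod, one_mul, Nat.mod_mod]
      rw [eps, eps, this]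
    have hleg : ((legendreSym p (-2 * r p a * c) : ℤ) : ℂ) ^ m =
        ((legendreSym p (-2 * r p a * c) : ℤ) : ℂ) := by
      rw [hk, pow_succ, pow_mul, hleg2, one_pow, one_mul]
    obtain ⟨X, hX⟩ := ZMod.intCast_surjective x₁
    have hXc : ((p : ℤ)) ^ m ∣ c + X * R p a j := by
      have h1 : ((c + X * R p a j : ℤ) : ZMod (p ^ m)) = 0 := by
        push_cast
        rw [hX]
        linear_combination hx₁c
      rw [ZMod.intCast_zmod_eq_zero_iff_dvd] at h1
      exact_mod_cast h1
    set ρ := R p a k with hρ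
    obtain ⟨h, hh⟩ : ∃ h : ℤ, 2 * h = p + 1 := ⟨((p : ℤ) + 1) / 2, by omega⟩
    -- v is an integer representing X ρ²/2 mod p, the coefficient of t² in the phase; p + 1 is even
    -- and ≡ 1 mod p.
    obtain ⟨v, hv2⟩ : ∃ v : ℤ, 2 * v = (p + 1) * (X * ρ ^ 2) :=
      ⟨h * (X * ρ ^ 2), by rw [← mul_assoc, hh]⟩
    have hR1 : ∀ i, 1 ≤ i → ((R p a i : ℤ) : ZMod p) = ((r p a : ℤ) : ZMod p) := by
      intro i hi
      rw [r_eq_R_one, ← sub_eq_zero, ← Int.cast_sub, ZMod.intCast_zmod_eq_zero_iff_dvd]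
      simpa using R_modEq hcop hp hp2 le_rfl hi
    have hXp : ((c : ZMod p) + X * r p a) = 0 := by
      have h1 : ((c + X * R p a j : ℤ) : ZMod p) = 0 := by
        rw [ZMod.intCast_zmod_eq_zero_iff_dvd]
        exact (dvd_pow_self _ (by omega)).trans hXc
      push_cast at h1
      rwa [hR1 j hj1] at h1
    have hv2p : 2 * (v : ZMod p) = X * (r p a : ZMod p) ^ 2 := by
      have := congrArg (Int.cast : ℤ → ZMod p) hv2
      push_cast at this
      rw [this, ZMod.natCast_self, hρ, hR1 k hk1]
      ring
    -- From 2v ≡ X r² and X r ≡ -c one gets 4v ≡ -2rc, so v and -2rc have the same Legendre symbol.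
    have hvleg : (2 ^ 2 : ZMod p) * v = ((-2 * r p a * c : ℤ) : ZMod p) := by
      push_cast
      linear_combination 2 * hv2p + (2 * (r p a : ZMod p)) * hXp
    have h2p : ((2 : ℤ) : ZMod p) ≠ 0 := by rwa [Ne, ZMod.intCast_zmod_eq_zero_iff_dvd]
    have hvnd : ¬ (p : ℤ) ∣ v := by
      intro hd
      rw [← ZMod.intCast_zmod_eq_zero_iff_dvd] at hd
      rw [hd, mul_zero] at hvleg
      exact hlegne hvleg.symm
    have hlegv : legendreSym p (-2 * r p a * c) = legendreSym p v := by
      have h1 : legendreSym p (-2 * r p a * c) = legendreSym p (2 ^ 2 * v) := by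
        rw [legendreSym, legendreSym, ← hvleg, Int.cast_mul, Int.cast_pow, Int.cast_ofNat]
      rw [h1, legendreSym.mul, legendreSym.sq_one' p h2p, one_mul]
    have hphase : ∀ (t : ℕ) (y : ℤ), (p : ℤ) ^ m ∣ 2 * (c * t * (p : ℤ) ^ k +
        X * ((1 + ρ * (p : ℤ) ^ k) ^ t - 1) - (p : ℤ) ^ (k + k) * y) →
        gaussTerm χ (x₁ * (1 + ρ * (p : ZMod (p ^ m)) ^ k) ^ t) =
          gaussTerm χ x₁ * ZMod.stdAddChar (y : ZMod p) := by
      intro t y hd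
      rw [gaussTerm_mul_pow χ (happ hk1)]
      congr 1
      have hpm : p ^ m = p ^ (k + k) * p := by rw [← pow_succ]; congr 1; omega
      rw [← stdAddChar_mul_left hpm]
      congr 1
      have hd' : (p : ℤ) ^ m ∣ (c * t * (p : ℤ) ^ k +
        X * ((1 + ρ * (p : ℤ) ^ k) ^ t - 1) - (p : ℤ) ^ (k + k) * y) :=
        IsCoprime.dvd_of_dvd_mul_left (hpZ.coprime_iff_not_dvd.2 h2).pow_left hd
      have h1 : ((c * t * (p : ℤ) ^ k + X * ((1 + ρ * (p : ℤ) ^ k) ^ t - 1) -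
          (p : ℤ) ^ (k + k) * y : ℤ) : ZMod (p ^ m)) = 0 := by
        rw [ZMod.intCast_zmod_eq_zero_iff_dvd]
        exact_mod_cast hd'
      push_cast at h1 ⊢
      rw [← hX]
      linear_combination h1
    rw [G_eq_of_odd χ hk1 hk' hx₁u (hst hk'.symm (by omega) (by omega) (by omega)) (R := ρ) (hR hk1),
      heps, hleg, hlegv, natCast_rpow_half_odd hp.pos hk']
    have hsum := sum_stdAddChar_mul_sq hp2 hvnd
    have hXk : (p : ℤ) ^ (k + 1) ∣ c + X * R p a j := (pow_dvd_pow _ (by omega)).trans hXc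
    have hRj : (p : ℤ) ^ (k + 1) ∣ R p a j - R p a (k + 1) :=
      R_modEq hcop hp hp2 (by omega) (by omega)
    by_cases h27 : p = 3 ∧ k = 1
    · obtain ⟨rfl, rfl⟩ := h27
      obtain rfl : m = 3 := hk'
      have hρ3 : (3 : ℤ) ∣ 1 - ρ ^ 2 := by
        have h3 : ¬ (3 : ℤ) ∣ ρ := hR le_rfl
        have : ρ % 3 = 1 ∨ ρ % 3 = 2 := by omega
        refine Int.dvd_of_emod_eq_zero ?_
        rcases this with h | h <;> simp [Int.sub_emod, pow_two, Int.mul_emod, h]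
      -- R_2 = ρ + 3ρ² + 3ρ³, so the defect is 9ρ² + 6ρ³ ≡ 6ρ³ mod 9.
      have hE : ((3 : ℕ) : ℤ) ^ (1 + 1) ∣ 2 * (R 3 a j - ρ) + ((3 : ℕ) : ℤ) ^ 1 * ρ ^ 2 - 6 * ρ ^ 3 := by
        have h1 := R_two_three_succ (by exact_mod_cast hcop) (le_refl 1)
        rw [← hρ] at h1
        obtain ⟨w, hw⟩ := hRj
        refine ⟨2 * w + ρ ^ 2, ?_⟩
        push_cast at h1 hw ⊢
        linear_combination 2 * hw + 2 * h1
      -- The defect makes the phase v t² - Xρ³ t mod 3, which is v(t - ρ)² - v because v = 2Xρ² and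
      -- ρ² ≡ 1.
      have hterm : ∀ t : ℕ, gaussTerm χ (x₁ * (1 + ρ * ((3 : ℕ) : ZMod (3 ^ 3)) ^ 1) ^ t) =
          gaussTerm χ x₁ * (ZMod.stdAddChar ((v : ZMod 3) * ((t : ZMod 3) + -(ρ : ZMod 3)) ^ 2) *
            ZMod.stdAddChar (-(v : ZMod 3))) := by
        intro t
        rw [hphase t (v * ((t - ρ) ^ 2 - 1)), ← AddChar.map_add_eq_mul]
        · congr 2
          push_cast
          ring
        · obtain ⟨w, hw⟩ := dvd_two_mul_phase_sub le_rfl hXk hE hv2 t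
          obtain ⟨e, he⟩ := hρ3
          have hv3 : v = 2 * (X * ρ ^ 2) := by push_cast at hv2; linarith
          refine ⟨w + 2 * (t * X * ρ ^ 3) + 2 * v * e, ?_⟩
          push_cast at hw ⊢
          linear_combination hw + 18 * v * he + 36 * t * ρ * hv3
      have hshift : ∑ s : ZMod 3, ZMod.stdAddChar ((v : ZMod 3) * (s + -(ρ : ZMod 3)) ^ 2) =
          ∑ s : ZMod 3, ZMod.stdAddChar ((v : ZMod 3) * s ^ 2) :=
        Equiv.sum_comp (Equiv.addRight (-(ρ : ZMod 3)))
          fun s => ZMod.stdAddChar ((v : ZMod 3) * s ^ 2)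
      -- -v ≡ 2v ≡ X r² ≡ -rc mod 3, the exponent of the extra cube root of unity.
      have hvc : -(v : ZMod 3) = ((-(r 3 a * c) : ℤ) : ZMod 3) := by
        have h3 : (3 : ZMod 3) = 0 := by exact ZMod.natCast_self 3
        push_cast
        linear_combination hv2p + (r 3 a : ZMod 3) * hXp - v * h3
      rw [Finset.sum_congr rfl fun t _ => hterm t, ← Finset.mul_sum, ← Finset.sum_mul, sum_range_natCast 3 fun s =>
        ZMod.stdAddChar ((v : ZMod 3) * (s + -(ρ : ZMod 3)) ^ 2),
        hshift, hsum, if_pos (by norm_num), hvc]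
      ring
    · have h27' : p ^ m ≠ 27 := by
        intro h
        have h3 : p ∣ 3 ^ 3 := by rw [show 3 ^ 3 = p ^ m from h.symm]; exact dvd_pow_self _ (by omega)
        obtain rfl := (Nat.prime_dvd_prime_iff_eq hp Nat.prime_three).1 (hp.dvd_of_dvd_pow h3)
        have : m = 3 := Nat.pow_right_injective (le_refl 2 |>.trans (by norm_num)) (show 3 ^ m = 3 ^ 3 from h)
        omega
      have hE : (p : ℤ) ^ (k + 1) ∣ 2 * (R p a j - ρ) + (p : ℤ) ^ k * ρ ^ 2 - 0 := by
        have := dvd_add (hRj.mul_left 2) (two_mul_R_succ hcop hp hp2 hk1 h27)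
        convert! this using 1
        ring
      have hterm : ∀ t : ℕ, gaussTerm χ (x₁ * (1 + ρ * (p : ZMod (p ^ m)) ^ k) ^ t) =
          gaussTerm χ x₁ * ZMod.stdAddChar ((v : ZMod p) * (t : ZMod p) ^ 2) := by
        intro t
        rw [hphase t (v * t ^ 2)]
        · push_cast; rfl
        · have := dvd_two_mul_phase_sub hk1 hXk hE hv2 t
          rw [← hk'] at this
          convert! this using 1
          ring
      rw [Finset.sum_congr rfl fun t _ => hterm t, ← Finset.mul_sum, sum_range_natCast p fun s => ZMod.stdAddChar ((v : ZMod p) * s ^ 2),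
        hsum, if_neg h27']
      ring

end Odd

/-! ### The prime 2 -/

theorem eight_dvd_sq_sub_one_of_odd {x : ℤ} (hx : Odd x) : (8 : ℤ) ∣ x ^ 2 - 1 := by
  obtain ⟨k, rfl⟩ := hx
  obtain ⟨j, hj⟩ := Int.even_mul_succ_self k
  exact ⟨j, by linear_combination 4 * hj⟩

/-- Three steps of the recursion add 2^(i-1)(R_i² + 2R_(i+1)² + 4R_(i+2)²), and odd squares are 1
mod 8, whence 7 = 1 + 2 + 4. Later steps only change the cofactor by multiples of 8; this is where j
must exceed i by 3. -/
theorem exists_Rtwo_sub_eq {i j : ℕ} (hi : 2 ≤ i) (hij : i + 3 ≤ j) :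
    ∃ w, Rtwo j - Rtwo i = 2 ^ (i - 1) * (7 + 8 * w) := by
  obtain ⟨w, hw⟩ := Rtwo_modEq (by omega : 2 ≤ i + 3) hij
  obtain ⟨a, ha⟩ := eight_dvd_sq_sub_one_of_odd (odd_Rtwo hi)
  obtain ⟨b, hb⟩ := eight_dvd_sq_sub_one_of_odd (odd_Rtwo (by omega : 2 ≤ i + 1))
  obtain ⟨d, hd⟩ := eight_dvd_sq_sub_one_of_odd (odd_Rtwo (by omega : 2 ≤ i + 2))
  have h1 := Rtwo_succ hi
  have h2 := Rtwo_succ (by omega : 2 ≤ i + 1)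
  have h3 := Rtwo_succ (by omega : 2 ≤ i + 2)
  obtain ⟨n, rfl⟩ := Nat.exists_eq_add_of_le' hi
  simp only [show n + 2 + 3 - 1 = n + 4 by omega, show n + 2 + 1 - 1 = n + 2 by omega,
    show n + 2 + 2 - 1 = n + 3 by omega, show n + 2 - 1 = n + 1 by omega] at hw h1 h2 h3 ⊢
  refine ⟨w + a + 2 * b + 4 * d, ?_⟩
  linear_combination hw + h1 + h2 + h3 + 2 ^ (n + 1) * ha + 2 ^ (n + 2) * hb + 2 ^ (n + 3) * hd

theorem omega_pow_eq (n : ℕ) : ZMod.stdAddChar ((n : ℤ) : ZMod 8) = omega ^ n := by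
  rw [ZMod.stdAddChar_coe, omega, ← Complex.exp_nat_mul]
  congr 1
  push_cast
  ring

theorem sqrt_two_mul_omega : (Real.sqrt 2 : ℂ) * omega = 1 + Complex.I := by
  have h : (Real.sqrt 2 : ℂ) ^ 2 = 2 := by
    exact_mod_cast Real.sq_sqrt (by norm_num : (0 : ℝ) ≤ 2)
  have : omega = ((Real.sqrt 2 : ℂ) / 2) * (1 + Complex.I) := by
    rw [omega, show (Real.pi * Complex.I / 4 : ℂ) = ((Real.pi / 4 : ℝ) : ℂ) * Complex.I by
      push_cast; ring, Complex.exp_mul_I, ← Complex.ofReal_cos, ← Complex.ofReal_sin,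
      Real.cos_pi_div_four, Real.sin_pi_div_four]
    push_cast
    ring
  rw [this]
  linear_combination (1 + Complex.I) / 2 * h

theorem omega_sq : omega ^ 2 = Complex.I := by
  have : ((2 : ℕ) : ℂ) * (Real.pi * Complex.I / 4) = Real.pi / 2 * Complex.I := by
    push_cast; ring
  rw [omega, ← Complex.exp_nat_mul, this, Complex.exp_pi_div_two_mul_I]

/-- Equivalently ω^c + ω^(-c) = 2 cos(πc/4) = √2 (2/c) for odd c, checked by c mod 8. -/
theorem one_add_omega_pow {c : ℕ} (hc : c % 2 = 1) :
    1 + omega ^ (2 * c) = (Real.sqrt 2 : ℂ) * ((jacobiSym 2 c : ℤ) : ℂ) * omega ^ c := by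
  have h1 := sqrt_two_mul_omega
  rw [← omega_sq] at h1
  have h4 : omega ^ 4 = -1 := by
    rw [show 4 = 2 * 2 from rfl, pow_mul, omega_sq, Complex.I_sq]
  have h8 : omega ^ 8 = 1 := by rw [show 8 = 4 * 2 from rfl, pow_mul, h4]; norm_num
  have hred : omega ^ c = omega ^ (c % 8) := by
    conv_lhs => rw [← Nat.div_add_mod c 8, pow_add, pow_mul, h8, one_pow, one_mul]
  rw [jacobiSym.at_two (Nat.odd_iff.2 hc), ZMod.χ₈_nat_eq_if_mod_eight, if_neg (by omega),
    mul_comm 2 c, pow_mul, hred]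
  have : c % 8 = 1 ∨ c % 8 = 3 ∨ c % 8 = 5 ∨ c % 8 = 7 := by omega
  rcases this with h | h | h | h
  · rw [h]; norm_num; linear_combination -h1
  · rw [h]; norm_num; linear_combination omega ^ 2 * h1 + (omega ^ 2 + 1) * h4
  · rw [h]; norm_num; linear_combination omega ^ 4 * h1 + (1 + omega ^ 6) * h4
  · rw [h]; norm_num
    linear_combination -omega ^ 6 * h1 + (1 - omega ^ 6) * (1 - omega ^ 4) * h4

section Two

variable {m : ℕ} (χ : DirichletCharacter ℂ (2 ^ m))

theorem apply_one_add_Rtwo {c : ℕ} (hc : IsIndex (2 ^ (m - 2)) (χ (5 : ZMod (2 ^ m))) c)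
    (hm : 2 ≤ m) {j : ℕ} (hj : 2 ≤ j) :
    χ (1 + (Rtwo j : ZMod (2 ^ m)) * ((2 : ℕ) : ZMod (2 ^ m)) ^ j) =
      ZMod.stdAddChar ((c : ZMod (2 ^ m)) * ((2 : ℕ) : ZMod (2 ^ m)) ^ j) := by
  have h1 := congrArg (Int.cast : ℤ → ZMod (2 ^ m)) (Rtwo_spec j hj)
  push_cast at h1
  push_cast
  rw [← h1, map_pow, pow_eq_stdAddChar_of_isIndex hc (q := 2 ^ m) (d := 2 ^ j) (by positivity)]
  · push_cast; rfl
  · obtain ⟨i, rfl⟩ := Nat.exists_eq_add_of_le' hj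
    obtain ⟨n, rfl⟩ := Nat.exists_eq_add_of_le' hm
    simp only [Nat.add_sub_cancel]
    ring

theorem two_not_dvd_Rtwo {j : ℕ} (hj : 2 ≤ j) : ¬ ((2 : ℕ) : ℤ) ∣ Rtwo j := by
  have := odd_Rtwo hj
  rw [← Int.not_even_iff_odd, even_iff_two_dvd] at this
  exact_mod_cast this

theorem G_two_of_five_le (hm : 5 ≤ m) (hχ : χ.IsPrimitive) {c j : ℕ}
    (hc : IsIndex (2 ^ (m - 2)) (χ (5 : ZMod (2 ^ m))) c) (hj : ⌈(m : ℚ) / 2⌉₊ + 2 ≤ j) :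
    G χ = ((((2 : ℕ) : ℝ) ^ ((m : ℝ) / 2) : ℝ) : ℂ) *
      gaussTerm χ (-(c : ZMod (2 ^ m)) * (Rtwo j : ZMod (2 ^ m))⁻¹) *
      ((jacobiSym 2 c : ℤ) : ℂ) ^ m * omega ^ c := by
  have happ : ∀ {i}, 2 ≤ i → _ := fun hi => apply_one_add_Rtwo χ hc (by omega) hi
  have hcp : ¬ 2 ∣ c := not_dvd_of_isPrimitive χ (by omega) hχ
    (two_not_dvd_Rtwo (by omega)) (happ (i := m - 1) (by omega))
  have hc2 : c % 2 = 1 := by omega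
  have hjm : m + 4 ≤ 2 * j := by
    have h := (Nat.le_ceil ((m : ℚ) / 2)).trans (Nat.cast_le (α := ℚ).2 (Nat.le_sub_of_add_le hj))
    rw [div_le_iff₀ (by norm_num)] at h
    have : m ≤ (j - 2) * 2 := by exact_mod_cast h
    omega
  have hjac2 : ((jacobiSym 2 c : ℤ) : ℂ) ^ 2 = 1 := by
    have : jacobiSym 2 c ^ 2 = 1 := jacobiSym.sq_one (by
      rw [show (2 : ℤ) = ((2 : ℕ) : ℤ) from rfl, Int.gcd_natCast_natCast]
      exact Nat.coprime_two_left.2 (Nat.odd_iff.2 hc2))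
    exact_mod_cast this
  set x₁ : ZMod (2 ^ m) := -(c : ZMod (2 ^ m)) * (Rtwo j : ZMod (2 ^ m))⁻¹ with hx₁
  have hRj : ¬ ((2 : ℕ) : ℤ) ∣ Rtwo j := two_not_dvd_Rtwo (by omega)
  have hx₁u : IsUnit x₁ := isUnit_neg_mul_inv hcp hRj
  have hx₁c : x₁ * (Rtwo j : ZMod (2 ^ m)) + c = 0 := neg_mul_inv_mul_cancel (p := 2) hRj _
  obtain ⟨X, hX⟩ := ZMod.intCast_surjective x₁
  have hXc : (2 : ℤ) ^ m ∣ c + X * Rtwo j := by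
    have h1 : ((c + X * Rtwo j : ℤ) : ZMod (2 ^ m)) = 0 := by
      push_cast
      rw [hX]
      linear_combination hx₁c
    rw [ZMod.intCast_zmod_eq_zero_iff_dvd] at h1
    exact_mod_cast h1
  -- Since R_j ≡ -1 mod 8, the congruence c + X R_j ≡ 0 becomes X ≡ c.
  have hX8 : (8 : ℤ) ∣ X - c := by
    have h1 : (8 : ℤ) ∣ c + X * Rtwo j :=
      (show (8 : ℤ) ∣ 2 ^ m from pow_dvd_pow 2 (by omega : 3 ≤ m)).trans hXc
    have h2 := eight_dvd_Rtwo_add_one (by omega : 4 ≤ j)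
    have := dvd_sub (h2.mul_left X) h1
    ring_nf at this ⊢
    exact this
  have hstat : ∀ {J K : ℕ} {Y : ℤ}, J + K = m → K ≤ J → 2 ≤ J →
      (2 : ℤ) ^ K ∣ Y * Rtwo J - X * Rtwo j → IsStationary χ J (Y : ZMod (2 ^ m)) := by
    intro J K Y hJK hKJ hJ hd
    refine isStationary_of_apply_eq χ (by omega) (c := (c : ℤ)) (two_not_dvd_Rtwo hJ) ?_ ?_
    · rw [happ hJ]; push_cast; rfl
    · have h1 : ((2 : ℕ) : ZMod (2 ^ m)) ^ J * ((Y * Rtwo J + c : ℤ) : ZMod (2 ^ m)) = 0 := by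
        rw [pow_mul_intCast_eq_zero_iff hJK]
        have := dvd_add hd ((pow_dvd_pow _ (by omega : K ≤ m)).trans hXc)
        convert! this using 1
        ring
      push_cast at h1 ⊢
      exact h1
  have hterm : ∀ {i d e : ℕ} {w : ℤ} [NeZero e], 2 ≤ i → 2 ^ m = d * e →
      2 ^ i * (X * (Rtwo i - Rtwo j)) = (d : ℤ) * w →
      gaussTerm χ (x₁ * (1 + (Rtwo i : ZMod (2 ^ m)) * ((2 : ℕ) : ZMod (2 ^ m)) ^ i)) =
        gaussTerm χ x₁ * ZMod.stdAddChar (w : ZMod e) := by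
    intro i d e w _ hi hde hw
    have h := gaussTerm_mul_pow χ (x₁ := x₁) (happ hi) 1
    rw [pow_one] at h
    rw [h, ← stdAddChar_mul_left hde, ← hw]
    congr 2
    push_cast
    rw [hX]
    linear_combination (2 ^ i : ZMod (2 ^ m)) * hx₁c
  rcases Nat.even_or_odd' m with ⟨k, hk | hk⟩
  · have hk' : m = k + k := by omega
    have hjac : ((jacobiSym 2 c : ℤ) : ℂ) ^ m = 1 := by rw [hk, pow_mul, hjac2, one_pow]
    obtain ⟨i, rfl⟩ : ∃ i, k = i + 1 := ⟨k - 1, by omega⟩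
    have hi : 2 ≤ i := by omega
    set u : ZMod (2 ^ m) := 1 + (Rtwo i : ZMod (2 ^ m)) * ((2 : ℕ) : ZMod (2 ^ m)) ^ i with hu
    have huu : IsUnit u := by
      rw [hu, mul_comm]
      exact isUnit_one_add_pow_mul (by omega) _
    -- The lost power of 2 means x₁ meets the critical equation only mod 2^i. The factor u = 1 + R_i
    -- 2^i supplies the missing digit, as R_(i+2) = R_(i+1)(1 + 2^i R_(i+1)) and R_i, R_(i+1) are
    -- both odd.
    have hst : IsStationary χ (i + 1) (x₁ * u) := by
      have hd : (2 : ℤ) ^ (i + 1) ∣ X * (1 + Rtwo i * 2 ^ i) * Rtwo (i + 1) - X * Rtwo j := by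
        obtain ⟨w, hw⟩ := Rtwo_modEq (by omega : 2 ≤ i + 2) (by omega : i + 2 ≤ j)
        have h2 := Rtwo_succ (by omega : 2 ≤ i + 1)
        obtain ⟨z, hz⟩ := (odd_Rtwo hi).sub_odd (odd_Rtwo (by omega : 2 ≤ i + 1))
        simp only [show i + 1 - 1 = i by omega, show i + 2 - 1 = i + 1 by omega] at h2 hw
        refine ⟨X * (z * Rtwo (i + 1) - w), ?_⟩
        linear_combination -X * hw - X * h2 + X * 2 ^ i * Rtwo (i + 1) * hz
      have := hstat hk'.symm le_rfl (by omega) hd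
      push_cast at this
      rw [hX] at this
      rw [hu]
      push_cast
      exact this
    obtain ⟨w, hw⟩ := exists_Rtwo_sub_eq hi (by omega : i + 3 ≤ j)
    rw [G_eq_of_even χ hk' (hx₁u.mul huu) hst, hjac, natCast_rpow_half_even hk', mul_one,
      hterm (d := 2 ^ (2 * i - 1)) (e := 8) (w := -(X * (7 + 8 * w))) hi, ← omega_pow_eq]
    -- -7 ≡ 1 and X ≡ c mod 8, so passing from x₁u to x₁ costs exactly ω^c.
    · have : ((-(X * (7 + 8 * w)) : ℤ) : ZMod 8) = ((c : ℤ) : ZMod 8) := by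
        rw [← sub_eq_zero, ← Int.cast_sub, ZMod.intCast_zmod_eq_zero_iff_dvd]
        obtain ⟨z, hz⟩ := hX8
        exact ⟨z - X - X * w, by push_cast; linear_combination hz⟩
      rw [this]
      ring
    · rw [hk, show 8 = 2 ^ 3 from rfl, ← pow_add]
      congr 1
      omega
    · push_cast
      obtain ⟨n, rfl⟩ : ∃ n, i = n + 1 := ⟨i - 1, by omega⟩
      rw [show 2 * (n + 1) - 1 = 2 * n + 1 by omega]
      rw [show n + 1 - 1 = n by omega] at hw
      linear_combination -(2 ^ (n + 1) * X) * hw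
  · have hk' : m = k + 1 + k := by omega
    have hk2 : 2 ≤ k := by omega
    have hjac : ((jacobiSym 2 c : ℤ) : ℂ) ^ m = ((jacobiSym 2 c : ℤ) : ℂ) := by
      rw [hk, pow_succ, pow_mul, hjac2, one_pow, one_mul]
    have hst : IsStationary χ (k + 1) x₁ := by
      rw [← hX]
      refine hstat hk'.symm (by omega) (by omega) ?_
      have h := Rtwo_modEq (by omega : 2 ≤ k + 1) (by omega : k + 1 ≤ j)
      rw [show k + 1 - 1 = k by omega] at h
      convert! (h.mul_left (-X)) using 1
      ring
    obtain ⟨w, hw⟩ := exists_Rtwo_sub_eq hk2 (by omega : k + 3 ≤ j)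
    have h1 := one_add_omega_pow hc2
    -- Here x₁ itself is critical, since precision 2^k suffices; the two classes give 1 + e(c/4) = 1
    -- + ω^(2c).
    rw [G_eq_of_odd χ (by omega) hk' hx₁u hst (two_not_dvd_Rtwo hk2), Finset.sum_range_succ,
      Finset.sum_range_one, pow_zero, pow_one, mul_one,
      hterm (d := 2 ^ (2 * k - 1)) (e := 4) (w := -(X * (7 + 8 * w))) hk2, hjac,
      natCast_rpow_half_odd (by norm_num) hk']
    · have h2 : ((-(X * (7 + 8 * w)) : ℤ) : ZMod 4) = ((c : ℤ) : ZMod 4) := by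
        rw [← sub_eq_zero, ← Int.cast_sub, ZMod.intCast_zmod_eq_zero_iff_dvd]
        obtain ⟨z, hz⟩ := hX8
        exact ⟨2 * z - 2 * X - 2 * X * w, by push_cast; linear_combination hz⟩
      have h3 : ZMod.stdAddChar ((c : ℤ) : ZMod 4) = omega ^ (2 * c) := by
        rw [← omega_pow_eq, ← stdAddChar_mul_left (show 8 = 2 * 4 from rfl)]
        push_cast
        rfl
      rw [h2, h3]
      push_cast
      linear_combination (2 ^ k * gaussTerm χ x₁) * h1
    · rw [hk, show 4 = 2 ^ 2 from rfl, ← pow_add]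
      congr 1
      omega
    · push_cast
      obtain ⟨n, rfl⟩ : ∃ n, k = n + 1 := ⟨k - 1, by omega⟩
      rw [show 2 * (n + 1) - 1 = 2 * n + 1 by omega]
      rw [show n + 1 - 1 = n by omega] at hw
      linear_combination -(2 ^ (n + 1) * X) * hw

theorem G_four (χ : DirichletCharacter ℂ (2 ^ 2)) (hχ : χ.IsPrimitive) :
    G χ = 2 * Complex.I := by
  have hst := not_isStationary_of_isPrimitive χ le_rfl hχ
  have hsq : χ 3 * χ 3 = 1 := by
    rw [← map_mul, show (3 : ZMod (2 ^ 2)) * 3 = 1 by decide, map_one]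
  -- If χ(3) were 1, χ would be trivial on 1 + 2ℤ, contradicting primitivity.
  have h3 : χ 3 = -1 := by
    refine (mul_self_eq_one_iff.1 hsq).resolve_left fun h => hst fun y => ?_
    rw [zero_mul, neg_zero, AddChar.map_zero_eq_one]
    have : ∀ y : ZMod (2 ^ 2), 1 + ((2 : ℕ) : ZMod (2 ^ 2)) ^ (2 - 1) * y = 1 ∨
        1 + ((2 : ℕ) : ZMod (2 ^ 2)) ^ (2 - 1) * y = 3 := by decide
    rcases this y with e | e
    · rw [e, map_one]
    · rw [e, h]
  have h0 : χ 0 = 0 := MulChar.map_nonunit χ (by decide)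
  have h2 : χ 2 = 0 := MulChar.map_nonunit χ (by decide)
  have e1 : (ZMod.stdAddChar (1 : ZMod (2 ^ 2)) : ℂ) = Complex.I := by
    have h := stdAddChar_mul_left (show 8 = 2 * 4 from rfl) 1
    have h' := omega_pow_eq 2
    rw [omega_sq] at h'
    rw [← h']
    exact h.symm
  have e3 : (ZMod.stdAddChar (3 : ZMod (2 ^ 2)) : ℂ) = -Complex.I := by
    rw [show (3 : ZMod (2 ^ 2)) = 3 • 1 by decide, AddChar.map_nsmul_eq_pow, e1]
    exact Complex.I_pow_three
  have hG : G χ = ∑ t ∈ Finset.range (2 ^ 2), gaussTerm χ (t : ZMod (2 ^ 2)) :=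
    (sum_range_natCast (2 ^ 2) (gaussTerm χ)).symm
  rw [hG, show Finset.range (2 ^ 2) = Finset.range 4 from rfl]
  simp only [gaussTerm, Finset.sum_range_succ, Finset.sum_range_zero, Nat.cast_zero, Nat.cast_one,
    Nat.cast_ofNat, h0, h2, h3, e1, e3, map_one χ]
  ring

/-- Primitivity forces χ(5) = -1, so the sum collapses to 2ω - 2χ(-1)ω³. The exponent 1 - χ(-1) is
complex, so the power is rewritten only after splitting on χ(-1) = ±1. -/
theorem G_eight (χ : DirichletCharacter ℂ (2 ^ 3)) (hχ : χ.IsPrimitive) :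
    G χ = 2 * Real.sqrt 2 * omega ^ (1 - χ (-1)) := by
  have hst := not_isStationary_of_isPrimitive χ (by norm_num) hχ
  have hsq : χ 5 * χ 5 = 1 := by
    rw [← map_mul, show (5 : ZMod (2 ^ 3)) * 5 = 1 by decide, map_one]
  have h5 : χ 5 = -1 := by
    refine (mul_self_eq_one_iff.1 hsq).resolve_left fun h => hst fun y => ?_
    rw [zero_mul, neg_zero, AddChar.map_zero_eq_one]
    have : ∀ y : ZMod (2 ^ 3), 1 + ((2 : ℕ) : ZMod (2 ^ 3)) ^ (3 - 1) * y = 1 ∨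
        1 + ((2 : ℕ) : ZMod (2 ^ 3)) ^ (3 - 1) * y = 5 := by decide
    rcases this y with e | e
    · rw [e, map_one]
    · rw [e, h]
  have hneg : χ (-1) * χ (-1) = 1 := by
    rw [← map_mul, show (-1 : ZMod (2 ^ 3)) * (-1) = 1 by decide, map_one]
  have h7 : χ 7 = χ (-1) := by rw [show (7 : ZMod (2 ^ 3)) = -1 by decide]
  have h3 : χ 3 = -χ (-1) := by
    rw [show (3 : ZMod (2 ^ 3)) = -1 * 5 by decide, map_mul, h5, mul_neg_one]
  have hψ : ∀ n : ℕ, (ZMod.stdAddChar (n : ZMod (2 ^ 3)) : ℂ) = omega ^ n := by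
    intro n
    rw [← omega_pow_eq, Int.cast_natCast]
  have h4 : omega ^ 4 = -1 := by
    rw [show 4 = 2 * 2 from rfl, pow_mul, omega_sq, Complex.I_sq]
  have hev : ∀ x : ZMod (2 ^ 3), x ^ 3 = 0 → χ x = 0 := by
    intro x hx
    have h0 : χ 0 = 0 := MulChar.map_nonunit χ (by decide)
    have := congrArg χ hx
    rw [map_pow, h0] at this
    exact pow_eq_zero_iff (by norm_num) |>.1 this
  have hG : G χ = ∑ t ∈ Finset.range (2 ^ 3), gaussTerm χ (t : ZMod (2 ^ 3)) :=
    (sum_range_natCast (2 ^ 3) (gaussTerm χ)).symm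
  have h1 := sqrt_two_mul_omega
  rw [← omega_sq] at h1
  have hval : G χ = 2 * omega - 2 * χ (-1) * omega ^ 3 := by
    have e0 := hev 0 (by decide)
    have e2 := hev 2 (by decide)
    have e4 := hev 4 (by decide)
    have e6 := hev 6 (by decide)
    rw [hG, show Finset.range (2 ^ 3) = Finset.range 8 from rfl]
    simp only [gaussTerm, hψ, Finset.sum_range_succ, Finset.sum_range_zero, Nat.cast_zero,
      Nat.cast_one, Nat.cast_ofNat, e0, e2, e4, e6, h3, h5, h7, map_one χ]
    linear_combination (-omega + χ (-1) * omega ^ 3) * h4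
  rw [hval]
  rcases mul_self_eq_one_iff.1 hneg with h | h
  · rw [h, sub_self, Complex.cpow_zero]
    linear_combination 2 * omega ^ 3 * h1 + (2 * omega - 2 * Real.sqrt 2) * h4
  · rw [h, sub_neg_eq_add, one_add_one_eq_two, Complex.cpow_ofNat]
    linear_combination (-2 * omega) * h1

/-- With J = 2 and R_2 = 1 the critical point is exactly -c, so no correction factor appears. -/
theorem G_sixteen (χ : DirichletCharacter ℂ (2 ^ 4)) (hχ : χ.IsPrimitive) {c : ℕ}
    (hc : IsIndex (2 ^ (4 - 2)) (χ (5 : ZMod (2 ^ 4))) c) :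
    G χ = 4 * gaussTerm χ (-(c : ZMod (2 ^ 4))) := by
  have hcp : ¬ 2 ∣ c := not_dvd_of_isPrimitive χ (by norm_num) hχ
    (two_not_dvd_Rtwo (by norm_num)) (apply_one_add_Rtwo χ hc (by norm_num) (j := 3) (by norm_num))
  have hu : IsUnit (-(c : ZMod (2 ^ 4))) := by
    have := isUnit_intCast_of_not_dvd (p := 2) (m := 4) (d := (c : ℤ)) (by exact_mod_cast hcp)
    rw [Int.cast_natCast] at this
    exact this.neg
  have hst : IsStationary χ 2 (-(c : ZMod (2 ^ 4))) := by
    refine isStationary_of_apply_eq χ (by norm_num) (c := (c : ℤ)) (two_not_dvd_Rtwo le_rfl) ?_ ?_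
    · rw [apply_one_add_Rtwo χ hc (by norm_num) le_rfl]; push_cast; rfl
    · rw [Rtwo_two]
      push_cast
      ring
  rw [G_eq_of_even χ (by norm_num) hu hst]
  norm_num

end Two

end PrimePowerGauss

end

/-! ### Assembly of the cases -/

theorem theorem2p1 (p m : ℕ) [Fact p.Prime] (hm : 2 ≤ m)
    (χ : DirichletCharacter ℂ (p ^ m)) :
    (¬ χ.IsPrimitive → PrimePowerGauss.G χ = 0) ∧
    (χ.IsPrimitive →
      -- odd `p`
      (p ≠ 2 → ∀ (a : ℤ) (c j : ℕ), PrimePowerGauss.IsPrimitiveRootMod a (p ^ m) →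
        PrimePowerGauss.IsIndex (Nat.totient (p ^ m)) (χ (a : ZMod (p ^ m))) c →
        ⌈(m : ℚ) / 2⌉₊ ≤ j →
        PrimePowerGauss.G χ =
          (((p : ℝ) ^ ((m : ℝ) / 2) : ℝ) : ℂ) *
            χ (-(c : ZMod (p ^ m)) * (PrimePowerGauss.R p a j : ZMod (p ^ m))⁻¹) *
            ZMod.stdAddChar (-(c : ZMod (p ^ m)) * (PrimePowerGauss.R p a j : ZMod (p ^ m))⁻¹) *
            ((legendreSym p (-2 * PrimePowerGauss.r p a * c) : ℤ) : ℂ) ^ m *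
            PrimePowerGauss.eps (p ^ m) *
            -- an extra cube root of unity, for the single modulus `27`
            (if p ^ m = 27 then
              ZMod.stdAddChar ((-(PrimePowerGauss.r p a * c) : ℤ) : ZMod 3) else 1)) ∧
      -- `p = 2`, `m ≥ 5`
      (p = 2 → 5 ≤ m → ∀ c j : ℕ,
        PrimePowerGauss.IsIndex (2 ^ (m - 2)) (χ (5 : ZMod (p ^ m))) c →
        ⌈(m : ℚ) / 2⌉₊ + 2 ≤ j →
        PrimePowerGauss.G χ =
          (((p : ℝ) ^ ((m : ℝ) / 2) : ℝ) : ℂ) *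
            χ (-(c : ZMod (p ^ m)) * (PrimePowerGauss.Rtwo j : ZMod (p ^ m))⁻¹) *
            ZMod.stdAddChar (-(c : ZMod (p ^ m)) * (PrimePowerGauss.Rtwo j : ZMod (p ^ m))⁻¹) *
            ((jacobiSym 2 c : ℤ) : ℂ) ^ m * PrimePowerGauss.omega ^ c) ∧
      -- `p = 2`, `m = 2, 3, 4`
      (p = 2 → m = 2 →
        PrimePowerGauss.G χ = (((p : ℝ) ^ ((m : ℝ) / 2) : ℝ) : ℂ) * Complex.I) ∧
      (p = 2 → m = 3 →
        PrimePowerGauss.G χ =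
          (((p : ℝ) ^ ((m : ℝ) / 2) : ℝ) : ℂ) * PrimePowerGauss.omega ^ (1 - χ (-1))) ∧
      (p = 2 → m = 4 → ∀ c : ℕ,
        PrimePowerGauss.IsIndex (2 ^ (m - 2)) (χ (5 : ZMod (p ^ m))) c →
        PrimePowerGauss.G χ =
          (((p : ℝ) ^ ((m : ℝ) / 2) : ℝ) : ℂ) * χ (-(c : ZMod (p ^ m))) *
            ZMod.stdAddChar (-(c : ZMod 16)))) := by
  refine ⟨PrimePowerGauss.G_eq_zero_of_not_isPrimitive χ hm, fun hχ => ⟨?_, ?_, ?_, ?_, ?_⟩⟩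
  · intro hp2 a c j ha hc hj
    rw [PrimePowerGauss.G_eq_of_odd_prime χ hp2 hm hχ ha hc hj, PrimePowerGauss.gaussTerm]
    ring
  · rintro rfl h5 c j hc hj
    rw [PrimePowerGauss.G_two_of_five_le χ h5 hχ hc hj, PrimePowerGauss.gaussTerm]
    ring
  · rintro rfl rfl
    rw [PrimePowerGauss.G_four χ hχ, PrimePowerGauss.natCast_rpow_half_even (k := 1) rfl]
    norm_num
  · rintro rfl rfl
    rw [PrimePowerGauss.G_eight χ hχ, PrimePowerGauss.natCast_rpow_half_odd (k := 1) two_pos rfl]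
    norm_num
  · rintro rfl rfl c hc
    rw [PrimePowerGauss.G_sixteen χ hχ hc, PrimePowerGauss.natCast_rpow_half_even (k := 2) rfl,
      PrimePowerGauss.gaussTerm, ← mul_assoc]
    norm_num
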